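/- **Setting and conventions.** All tensors and connections on $\mathbb R^p$ (state space) and $\mathbb R^q$ (observation space) are written in coordinates; a connection is given by its connector $\Gamma(x)(u\otimes v)$. For a field $H$ of symmetric bilinear forms put $K_H(u,v,w)=D\langle v,w\rangle_H(u)+D\langle w,u\rangle_H(v)-D\langle u,v\rangle_H(w)$. A *filtering model* $(b,\sigma,g,\psi,\beta)$ consists of a state equation $dX=b(X)\,dt+\sigma(X)\,dW$ with diffusion variance $\alpha=\sigma\sigma^T$ of constant rank (possibly degenerate), a Riemannian metric $g$ with $\alpha g\alpha=\alpha$, an observation function $\psi:\mathbb R^p\to\mathbb R^q$ and a positive definite observation covariance metric $\beta$. The state space carries the canonical sub-Riemannian connection $$2g(\Gamma(u\otimes v))\cdot w=K_{g\alpha g}(u,v,w)+K_g(u,v,(I-\alpha g)w)$$ (the Levi-Civita connection of $\alpha^{-1}$ if $\alpha$ is non-degenerate; the last term also vanishes where $g$ is constant), the observation space the Levi-Civita connection $\bar\Gamma$ of $\beta^{-1}$. Let $\xi=b+\frac12\sum\alpha^{ij}\Gamma_{ij}$, and for a map $f$ between spaces with connectors let $\nabla df(u\otimes v)=D^2f(u\otimes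 v)-Df\,\Gamma(u\otimes v)+\Gamma'(Df\,u\otimes Df\,v)$. A random variable $S$ is *centered at $x$ with covariance tensor $\Sigma$* if $\exp_x^{-1}S$ has mean $0$ and second moments $\Sigma$. A diffusion $X$ observed through $Y_1,Y_2,\dots$ at times $t_1<t_2<\dots$ *follows* the models $S_n$ on $[t_n,t_{n+1}]$ (which may depend on $Y_1,\dots,Y_n$) if it solves the state equation there (as a martingale problem) and, given the state up to time $t_{n+1}$ and $Y_1,\dots,Y_n$, the observation $Y_{n+1}$ has a conditional law that depends only on $X_{t_{n+1}}$ and $Y_1,\dots,Y_n$ and is centered at $\psi(X_{t_{n+1}})$ with covariance tensor $\beta(\psi(X_{t_{n+1}}))$. **GI Filter.** One cycle, over a time $\delta$, from $(x_0,\Sigma_0)$ and an observation $Y$: let $\Phi_t$ be the flow of $\xi$, $x_t=\Phi_t(x_0)$, $\tau_s^t=d(\Phi_t\circ\Phi_s^{-1})(x_s)$, $\Pi_t=\Sigma_0+\int_0^t\tau_s^0\alpha(x_s)(\tau_s^0)^Tds$, $\Xi=\tau_0^\delta\,\Pi_\delta\,(\tau_0^\delta)^T$, $y_\delta=\psi(x_\delta)$,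 $J=D\psi(x_\delta)$, $$I_X=\tfrac12\Big\{\nabla d\Phi_\delta(x_0)(\Pi_\delta)-\int_0^\delta\tau_t^\delta\,\nabla d\Phi_t(x_0)(d\Pi_t)\Big\},\qquad I_\psi=\tfrac12\nabla d\psi(x_\delta)(\Xi)+J\,I_X,$$ $$G=\Xi J^T[J\Xi J^T+\beta(y_\delta)]^{-1},\qquad \rho_0(u\otimes v)=\tfrac12\{(I-GJ)\nabla d\Phi_\delta(x_0)(\tau_\delta^0u\otimes\tau_\delta^0v)-G\,\nabla d\psi(x_\delta)(u\otimes v)\},$$ $$\hat Z=\exp_{y_\delta}^{-1}(Y)-I_\psi,\quad \mu=I_X+G\hat Z+\rho_0(G\hat Z\otimes G\hat Z)-\rho_0(GJ\Xi),\quad \Sigma=(I-GJ)\Xi .$$ With $R$ the curvature of $\Gamma$ (derivatives of $\Gamma$ in the weak sense), sign convention $R(\zeta,\eta)\kappa=D\Gamma(\eta)(\zeta\otimes\kappa)-D\Gamma(\zeta)(\eta\otimes\kappa)+\Gamma(\eta\otimes\Gamma(\zeta\otimes\kappa))-\Gamma(\zeta\otimes\Gamma(\eta\otimes\kappa))$,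 $R_{ijk}=R(e_i,e_j)e_k$ and $v=\mu-\frac13\sum R_{ijk}\mu^i\Sigma^{jk}$, the new state estimate is $\exp_{x_\delta}(v)$ and the new covariance tensor is $F\Sigma F^T$, where $F$ is the derivative of $\exp_{x_\delta}$ at $v$. **Proposition 6.2.a.** Let $0=t_0<t_1<t_2<\cdots$ and let $X$ be an Ornstein–Uhlenbeck process with Gaussian initial law $N(m_0,C_0)$ and $$dX_t=A_nX_t\,dt+\sigma_n\,dW_t\quad(t_n\le t\le t_{n+1}),\qquad Y_{n+1}=J_nX_{t_{n+1}}+V_{n+1},\qquad n\ge0,$$ where, given the state up to time $t_{n+1}$ and $Y_1,\dots,Y_n$, $V_{n+1}\sim N(0,B_n)$ with $B_n$ positive definite, and $A_n,\sigma_n\in\mathbb R^{p\times p}$, $J_n\in\mathbb R^{q\times p}$, $B_n$ are functions of $Y_1,\dots,Y_n$. The matrices $\sigma_n$ may be singular; on $[t_n,t_{n+1}]$ let $g_n$ be any (in these coordinates constant) positive definite matrix with $\sigma_n\sigma_n^Tg_n\sigma_n\sigma_n^T=\sigma_n\sigma_n^T$. Let $(\hat\mu^o_n,\hat\Sigma^o_n)_{n\ge0}$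 be the Kalman filter estimates, started from $(\hat\mu_0^o,\hat\Sigma_0^o)=(m_0,C_0)$. Let $\phi:\mathbb R^p\to\mathbb R^p$ and $\theta:\mathbb R^q\to\mathbb R^q$ be arbitrary $C^2$ diffeomorphisms. Then: 1. The diffusion $\phi(X_t)$ with observations $\theta(Y_n)$ follows the models obtained from $(A_nx,\sigma_n,g_n,J_nx,B_n)$ by transforming the drift with Itô's formula, the other coefficients as tensors and the observation function to $\theta\circ J_n\circ\phi^{-1}$; its initial state is centered at $\phi(m_0)$ with covariance tensor $D\phi(m_0)\,C_0\,D\phi(m_0)^T$. 2. The GI Filter for this transformed system, started from that initial estimate, is well defined, and for every realization of the observations and every $n\ge0$ its state estimate after $n$ observations is $\phi(\hat\mu_n^o)$ and its covariance tensor is $D\phi(\hat\mu_n^o)\,\hat\Sigma_n^o\,D\phi(\hat\mu_n^o)^T$. -/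

import Mathlib

open MeasureTheory ProbabilityTheory Set Filter
open scoped Matrix Topology

noncomputable section

namespace GIF

/-- Coordinate space of dimension `n`. Only its topology, differentiable structure and Lebesgue
measure are used below, never a norm. -/
abbrev Vec (n : ℕ) : Type := Fin n → ℝ

/-- A contravariant 2-tensor (for instance a covariance tensor) in coordinates, or the matrix of a
linear map. -/
abbrev Mat (m n : ℕ) : Type := Matrix (Fin m) (Fin n) ℝ

/-- The `i`-th coordinate vector. -/
abbrev basisVec {n : ℕ} (i : Fin n) : Vec n := Pi.single i 1

/-! ### Calculus in coordinates -/

/-- Jacobian matrix `Df(x)`. -/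
def jac {n m : ℕ} (f : Vec n → Vec m) (x : Vec n) : Mat m n :=
  Matrix.of fun i j => fderiv ℝ f x (basisVec j) i

/-- Second derivative `D²f(x)(u ⊗ v)`. -/
def hess {n : ℕ} {F : Type*} [NormedAddCommGroup F] [NormedSpace ℝ F]
    (f : Vec n → F) (x u v : Vec n) : F :=
  fderiv ℝ (fderiv ℝ f) x u v

/-- Value of a bilinear map `T` on the 2-tensor `S = ∑ S i j • e i ⊗ e j`. -/
def contract {n : ℕ} {F : Type*} [AddCommGroup F] [Module ℝ F]
    (T : Vec n → Vec n → F) (S : Mat n n) : F :=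
  ∑ i, ∑ j, S i j • T (basisVec i) (basisVec j)

/-! ### Connections in coordinates

A connection on `ℝⁿ` is given by its local connector `Γ x u v`
(`∇_{∂ᵢ} ∂ⱼ` at `x` is `Γ x eᵢ eⱼ`). -/

/-- A local connector on `ℝⁿ`. -/
abbrev Connector (n : ℕ) : Type := Vec n → Vec n → Vec n → Vec n

/-- `D⟨v, w⟩(u) + D⟨w, u⟩(v) - D⟨u, v⟩(w)` at `x`, for the field `G` of bilinear forms on tangent
vectors. -/
def koszul {n : ℕ} (G : Vec n → Mat n n) (x u v w : Vec n) : ℝ :=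
  fderiv ℝ (fun z => v ⬝ᵥ G z *ᵥ w) x u + fderiv ℝ (fun z => w ⬝ᵥ G z *ᵥ u) x v
    - fderiv ℝ (fun z => u ⬝ᵥ G z *ᵥ v) x w

/-- Connector of the Levi-Civita connection of the metric tensor `G`:
`2 G(Γ(u ⊗ v), w) = D⟨v, w⟩(u) + D⟨w, u⟩(v) - D⟨u, v⟩(w)`. -/
def leviCivita {n : ℕ} (G : Vec n → Mat n n) : Connector n := fun x u v =>
  (G x)⁻¹ *ᵥ fun k => (1 / 2) * koszul G x u v (basisVec k)

/-- Connector of the canonical sub-Riemannian connection of the (possibly degenerate) diffusion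
variance `α`, relative to a Riemannian metric `g` which is a generalized inverse of `α`:
`2 g(Γ(u ⊗ v)) · w = D⟨g v | g w⟩(u) + D⟨g w | g u⟩(v) - D⟨g u | g v⟩(w) + K_g(u, v, (1 - α g) w)`,
where `⟨θ | λ⟩ = θ · α λ` is the diffusion variance on covectors and `K_g` is the same Koszul
expression formed with `g` itself.
The last summand is zero when `α` is non-degenerate (then `α g = 1`, and `Γ` is the Levi-Civita
connector) and also in coordinates in which `g` is constant; it is what makes the right-hand side
transform as a connector under changes of coordinates when `α` is degenerate. -/
def subRiemannian {n : ℕ} (α g : Vec n → Mat n n) : Connector n := fun x u v =>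
  (g x)⁻¹ *ᵥ fun k =>
    (1 / 2) * (koszul (fun z => g z * α z * g z) x u v (basisVec k)
      + koszul g x u v ((1 - α x * g x) *ᵥ basisVec k))

/-- Second fundamental form `∇df(x)(u ⊗ v)` of a map between spaces with connectors `Γ`, `Γ'`. -/
def secondFundForm {n m : ℕ} (Γ : Connector n) (Γ' : Connector m) (f : Vec n → Vec m)
    (x u v : Vec n) : Vec m :=
  hess f x u v - jac f x *ᵥ Γ x u v + Γ' (f x) (jac f x *ᵥ u) (jac f x *ᵥ v)

/-- `exp_x v = y`: some geodesic `c` on `[0, 1]` starts at `x` with velocity `v` and ends at `y`. -/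
def IsExp {n : ℕ} (Γ : Connector n) (x v y : Vec n) : Prop :=
  ∃ c ζ : ℝ → Vec n, c 0 = x ∧ ζ 0 = v ∧ c 1 = y ∧
    ∀ s ∈ Icc (0 : ℝ) 1, HasDerivWithinAt c (ζ s) (Icc 0 1) s ∧
      HasDerivWithinAt ζ (-Γ (c s) (ζ s) (ζ s)) (Icc 0 1) s

/-- `R x ζ η κ` is the curvature `R(ζ, η)κ` of the connector `Γ`, i.e. `R` is continuous and
`R(ζ, η)κ = DΓ(η)(ζ ⊗ κ) - DΓ(ζ)(η ⊗ κ) + Γ(η ⊗ Γ(ζ ⊗ κ)) - Γ(ζ ⊗ Γ(η ⊗ κ))`,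
the derivatives of `Γ` being weak derivatives. (A `C²` change of coordinates turns a smooth
connector into one that is only continuous; where `Γ` is `C¹` this is the classical curvature.) -/
def IsCurvature {n : ℕ} (Γ : Connector n) (R : Vec n → Vec n → Vec n → Vec n → Vec n) : Prop :=
  (∀ ζ η κ, Continuous fun x => R x ζ η κ) ∧
  ∀ h : Vec n → ℝ, ContDiff ℝ (⊤ : ℕ∞) h → HasCompactSupport h → ∀ ζ η κ : Vec n,
    ∫ x, h x • R x ζ η κ =
      ∫ x, (-(fderiv ℝ h x η • Γ x ζ κ) + fderiv ℝ h x ζ • Γ x η κ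
        + h x • (Γ x η (Γ x ζ κ) - Γ x ζ (Γ x η κ)))

/-- A random variable with law `ν` is centered at `x` with covariance tensor `S`: the tangent vector
`exp_x⁻¹` of it has mean zero and second moments `S`. -/
def IsCenteredAt {n : ℕ} (Γ : Connector n) (ν : Measure (Vec n)) (x : Vec n) (S : Mat n n) :
    Prop :=
  ∃ l : Vec n → Vec n, Measurable l ∧ (∀ᵐ s ∂ν, IsExp Γ x (l s) s) ∧
    (∀ i, Integrable (fun s => l s i) ν ∧ ∫ s, l s i ∂ν = 0) ∧
    (∀ i j, Integrable (fun s => l s i * l s j) ν ∧ ∫ s, l s i * l s j ∂ν = S i j)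

/-! ### Filtering models -/

/-- Coefficients, in coordinates, of a nonlinear filtering model on one observation interval:
drift `b` and diffusion coefficient `σ` of the state equation `dX = b(X) dt + σ(X) dW`, the
generalized inverse `g` of the diffusion variance, the observation function `ψ`, and the observation
covariance metric `β` (a metric on covectors of the observation space). -/
structure Model (p q : ℕ) where
  b : Vec p → Vec p
  σ : Vec p → Mat p p
  g : Vec p → Mat p p
  ψ : Vec p → Vec q
  β : Vec q → Mat q q

/-- The generator `∑ bⁱ Dᵢ f + (1/2) ∑ (σ σᵀ)ⁱʲ Dᵢⱼ f` of `dX = b(X) dt + σ(X) dW`. -/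
def generator {p : ℕ} (b : Vec p → Vec p) (σ : Vec p → Mat p p) (f : Vec p → ℝ) (x : Vec p) : ℝ :=
  fderiv ℝ f x (b x) + (1 / 2) * contract (hess f x) (σ x * (σ x)ᵀ)

/-- For a flow `Φ`, `tau Φ x₀ s t = d(Φ_t ∘ Φ_s⁻¹)(x_s)`, where `x_s = Φ_s(x₀)`. -/
def tau {p : ℕ} (Φ : ℝ → Vec p → Vec p) (x₀ : Vec p) (s t : ℝ) : Mat p p :=
  jac (Φ t) x₀ * (jac (Φ s) x₀)⁻¹

namespace Model

variable {p q : ℕ} (S : Model p q)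

/-- The diffusion variance. -/
def α (x : Vec p) : Mat p p := S.σ x * (S.σ x)ᵀ

/-- Connector on the state space. -/
def stateConn : Connector p := subRiemannian S.α S.g

/-- Connector on the observation space: Levi-Civita connection of the metric tensor `β⁻¹`. -/
def obsConn : Connector q := leviCivita fun y => (S.β y)⁻¹

/-- The intrinsic vector field `ξ = b + (1/2) ∑ αⁱʲ Γᵢⱼ`. -/
def ξ (x : Vec p) : Vec p := S.b x + (1 / 2 : ℝ) • contract (S.stateConn x) (S.α x)

/-- Standing requirements on a model: enough regularity for the connectors and second fundamental
forms to exist classically, a diffusion variance of constant rank, a Riemannian metric `g` which is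
a generalized inverse of it, and a non-degenerate observation covariance. -/
structure IsAdmissible : Prop where
  b_cont : Continuous S.b
  σ_smooth : ∀ i j, ContDiff ℝ 1 fun x => S.σ x i j
  g_smooth : ∀ i j, ContDiff ℝ 1 fun x => S.g x i j
  ψ_smooth : ContDiff ℝ 2 S.ψ
  β_smooth : ∀ i j, ContDiff ℝ 1 fun y => S.β y i j
  const_rank : ∃ r : ℕ, ∀ x, (S.σ x).rank = r
  g_posDef : ∀ x, (S.g x).PosDef
  g_inverse : ∀ x, S.α x * S.g x * S.α x = S.α x
  β_posDef : ∀ y, (S.β y).PosDef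

/-- The model in the coordinates `φ` on the state space and `θ` on the observation space: the drift
is transformed by Itô's formula, and `σ`, `g`, `β` as tensors. -/
def map (φ : Vec p ≃ Vec p) (θ : Vec q ≃ Vec q) : Model p q where
  b x := jac φ (φ.symm x) *ᵥ S.b (φ.symm x)
    + (1 / 2 : ℝ) • contract (hess φ (φ.symm x)) (S.α (φ.symm x))
  σ x := jac φ (φ.symm x) * S.σ (φ.symm x)
  g x := ((jac φ (φ.symm x))⁻¹)ᵀ * S.g (φ.symm x) * (jac φ (φ.symm x))⁻¹
  ψ x := θ (S.ψ (φ.symm x))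
  β y := jac θ (θ.symm y) * S.β (θ.symm y) * (jac θ (θ.symm y))ᵀ

/-! ### Intrinsic quantities of a model on a time interval

`Φ` is the flow of `ξ`, `x₀` and `S₀` are the initial state estimate and covariance tensor. -/

/-- `Φ` is the (non-exploding, invertible) flow of the vector field `ξ`. -/
def IsFlow (Φ : ℝ → Vec p → Vec p) : Prop :=
  ∀ x, Φ 0 x = x ∧ ∀ t, HasDerivAt (fun s => Φ s x) (S.ξ (Φ t x)) t

/-- The time derivative `(Φ_{-t})_* α(x_t)` of the tensor `Π_t`. -/
def dPi (Φ : ℝ → Vec p → Vec p) (x₀ : Vec p) (t : ℝ) : Mat p p :=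
  tau Φ x₀ t 0 * S.α (Φ t x₀) * (tau Φ x₀ t 0)ᵀ

/-- `Π_t = Σ₀ + ∫₀ᵗ (Φ_{-s})_* α(x_s) ds`. -/
def PiTensor (Φ : ℝ → Vec p → Vec p) (x₀ : Vec p) (S₀ : Mat p p) (t : ℝ) : Mat p p :=
  S₀ + Matrix.of fun i j => ∫ s in (0 : ℝ)..t, S.dPi Φ x₀ s i j

/-- `Ξ_t = (Φ_t)_* Π_t`. -/
def Xi (Φ : ℝ → Vec p → Vec p) (x₀ : Vec p) (S₀ : Mat p p) (t : ℝ) : Mat p p :=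
  tau Φ x₀ 0 t * S.PiTensor Φ x₀ S₀ t * (tau Φ x₀ 0 t)ᵀ

/-- Second fundamental form `∇dΦ_t(x₀)` of the flow. -/
def flowForm (Φ : ℝ → Vec p → Vec p) (x₀ : Vec p) (t : ℝ) : Vec p → Vec p → Vec p :=
  secondFundForm S.stateConn S.stateConn (Φ t) x₀

/-- Second fundamental form `∇dψ(x)` of the observation function. -/
def obsForm (x : Vec p) : Vec p → Vec p → Vec q :=
  secondFundForm S.stateConn S.obsConn S.ψ x

/-- Approximate intrinsic location parameter of the state at time `δ`. -/
def stateAILP (Φ : ℝ → Vec p → Vec p) (x₀ : Vec p) (S₀ : Mat p p) (δ : ℝ) : Vec p :=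
  (1 / 2 : ℝ) • (contract (S.flowForm Φ x₀ δ) (S.PiTensor Φ x₀ S₀ δ)
    - ∫ t in (0 : ℝ)..δ, tau Φ x₀ t δ *ᵥ contract (S.flowForm Φ x₀ t) (S.dPi Φ x₀ t))

/-- Approximate intrinsic location parameter of `ψ` of the state at time `δ`. -/
def obsAILP (Φ : ℝ → Vec p → Vec p) (x₀ : Vec p) (S₀ : Mat p p) (δ : ℝ) : Vec q :=
  (1 / 2 : ℝ) • (contract (S.obsForm (Φ δ x₀)) (S.Xi Φ x₀ S₀ δ)
    + jac S.ψ (Φ δ x₀) *ᵥ (contract (S.flowForm Φ x₀ δ) (S.PiTensor Φ x₀ S₀ δ)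
      - ∫ t in (0 : ℝ)..δ, tau Φ x₀ t δ *ᵥ contract (S.flowForm Φ x₀ t) (S.dPi Φ x₀ t)))

/-- The gain `G = Ξ Jᵀ (J Ξ Jᵀ + β)⁻¹`. -/
def gain (Φ : ℝ → Vec p → Vec p) (x₀ : Vec p) (S₀ : Mat p p) (δ : ℝ) : Mat p q :=
  S.Xi Φ x₀ S₀ δ * (jac S.ψ (Φ δ x₀))ᵀ *
    (jac S.ψ (Φ δ x₀) * S.Xi Φ x₀ S₀ δ * (jac S.ψ (Φ δ x₀))ᵀ + S.β (S.ψ (Φ δ x₀)))⁻¹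

/-- The quadratic coefficient of the filter, as a bilinear map of vectors in the tangent space of
the state space at `x_δ`: `ρ(z ⊗ z) = rho (G z) (G z)`, and `rho` contracted with
`G J Ξ = G (J Ξ Jᵀ + β) Gᵀ` is the term that is subtracted in the update. -/
def rho (Φ : ℝ → Vec p → Vec p) (x₀ : Vec p) (S₀ : Mat p p) (δ : ℝ) (u v : Vec p) : Vec p :=
  (1 / 2 : ℝ) • ((1 - S.gain Φ x₀ S₀ δ * jac S.ψ (Φ δ x₀)) *ᵥ
      S.flowForm Φ x₀ δ (tau Φ x₀ δ 0 *ᵥ u) (tau Φ x₀ δ 0 *ᵥ v)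
    - S.gain Φ x₀ S₀ δ *ᵥ S.obsForm (Φ δ x₀) u v)

/-- The approximate conditional mean, in the tangent space at `x_δ`, of `exp⁻¹` of the state, given
the observation pulled back to `Z` in the tangent space at `ψ(x_δ)`. -/
def condMean (Φ : ℝ → Vec p → Vec p) (x₀ : Vec p) (S₀ : Mat p p) (δ : ℝ) (Z : Vec q) : Vec p :=
  let G := S.gain Φ x₀ S₀ δ
  let Zhat := Z - S.obsAILP Φ x₀ S₀ δ
  S.stateAILP Φ x₀ S₀ δ + G *ᵥ Zhat + S.rho Φ x₀ S₀ δ (G *ᵥ Zhat) (G *ᵥ Zhat)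
    - contract (S.rho Φ x₀ S₀ δ) (G * jac S.ψ (Φ δ x₀) * S.Xi Φ x₀ S₀ δ)

/-- The approximate conditional variance `(1 - G J) Ξ` in the tangent space at `x_δ`. -/
def condVar (Φ : ℝ → Vec p → Vec p) (x₀ : Vec p) (S₀ : Mat p p) (δ : ℝ) : Mat p p :=
  (1 - S.gain Φ x₀ S₀ δ * jac S.ψ (Φ δ x₀)) * S.Xi Φ x₀ S₀ δ

/-- One cycle of the GI filter: from the estimate `(x₀, S₀)` at the beginning of a time interval of
length `δ` and the observation `Y` at its end, to the estimate `(x₁, S₁)`. Here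
`Z = exp⁻¹(Y)` at `ψ(x_δ)`, the new state estimate is `exp_{x_δ}(v)` with
`v = μ - (1/3) ∑ R_{ijk} μⁱ Σʲᵏ`, and the new covariance tensor is the push-forward of `Σ` under the
derivative at `v` of the exponential map (`e`, defined near `v`) at `x_δ`. -/
def GIStep (δ : ℝ) (x₀ : Vec p) (S₀ : Mat p p) (Y : Vec q) (x₁ : Vec p) (S₁ : Mat p p) : Prop :=
  ∃ (Φ : ℝ → Vec p → Vec p) (R : Vec p → Vec p → Vec p → Vec p → Vec p) (Z : Vec q)
    (e : Vec p → Vec p) (v : Vec p),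
    S.IsFlow Φ ∧ IsCurvature S.stateConn R ∧ IsExp S.obsConn (S.ψ (Φ δ x₀)) Z Y ∧
    v = S.condMean Φ x₀ S₀ δ Z - (1 / 3 : ℝ) • ∑ i, ∑ j, ∑ k,
      (S.condMean Φ x₀ S₀ δ Z i * S.condVar Φ x₀ S₀ δ j k) •
        R (Φ δ x₀) (basisVec i) (basisVec j) (basisVec k) ∧
    (∀ᶠ w in 𝓝 v, IsExp S.stateConn (Φ δ x₀) w (e w)) ∧ DifferentiableAt ℝ e v ∧
    x₁ = e v ∧ S₁ = jac e v * S.condVar Φ x₀ S₀ δ * (jac e v)ᵀ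

end Model

/-- `(m n, C n)`, `n = 0, 1, …`, are the state estimates and covariance tensors produced by the GI
filter started at `(m₀, C₀)`, when the model is `S n` on `[t n, t (n + 1)]` and the observation made
at time `t n` is `y n`, `n = 1, 2, …` (`y 0` is not used). -/
def IsGIFilter {p q : ℕ} (t : ℕ → ℝ) (S : ℕ → Model p q) (y : ℕ → Vec q) (m₀ : Vec p)
    (C₀ : Mat p p) (m : ℕ → Vec p) (C : ℕ → Mat p p) : Prop :=
  m 0 = m₀ ∧ C 0 = C₀ ∧
    ∀ n, (S n).GIStep (t (n + 1) - t n) (m n) (C n) (y (n + 1)) (m (n + 1)) (C (n + 1))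

/-! ### The processes -/

section Processes

variable {Ω : Type*} [MeasurableSpace Ω] {p q : ℕ}

/-- The sigma-field generated by the observations `Y 1, …, Y n`. -/
@[reducible]
def obsSigma (Y : ℕ → Ω → Vec q) (n : ℕ) : MeasurableSpace Ω :=
  ⨆ k ∈ Icc 1 n, MeasurableSpace.comap (Y k) inferInstance

/-- The sigma-field generated by the state up to time `r`. -/
@[reducible]
def stateSigma (X : ℝ → Ω → Vec p) (r : ℝ) : MeasurableSpace Ω :=
  ⨆ s ∈ Icc (0 : ℝ) r, MeasurableSpace.comap (X s) inferInstance

/-- The sigma-field generated by the state and by the observations up to time `r`. -/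
@[reducible]
def history (t : ℕ → ℝ) (X : ℝ → Ω → Vec p) (Y : ℕ → Ω → Vec q) (r : ℝ) : MeasurableSpace Ω :=
  stateSigma X r ⊔ ⨆ k ∈ {k : ℕ | 1 ≤ k ∧ t k ≤ r}, MeasurableSpace.comap (Y k) inferInstance

/-- On `[t n, t (n + 1)]` the process `X` is a diffusion satisfying
`dX = b n (X) dt + σ n (X) dW`, as a martingale problem (equivalently, `X` is a weak solution): for
every compactly supported `C²` function `f`, with `L` the generator, `f(X_r) - ∫ L f (X_u) du` is a
martingale for the history of the state and the observations. The coefficients may depend on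
the past observations, whence the localization to events on which `L f` is bounded. -/
def IsDiffusion (P : Measure Ω) (t : ℕ → ℝ) (X : ℝ → Ω → Vec p) (Y : ℕ → Ω → Vec q)
    (b : ℕ → Ω → Vec p → Vec p) (σ : ℕ → Ω → Vec p → Mat p p) : Prop :=
  ∀ n : ℕ, ∀ f : Vec p → ℝ, ContDiff ℝ 2 f → HasCompactSupport f →
    ∀ s r : ℝ, t n ≤ s → s ≤ r → r ≤ t (n + 1) →
    ∀ D : Set Ω, MeasurableSet[history t X Y s] D →
      (∃ c : ℝ, ∀ ω ∈ D, ∀ x, |generator (b n ω) (σ n ω) f x| ≤ c) →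
      ∫ ω in D, (f (X r ω) - f (X s ω)
        - ∫ u in s..r, generator (b n ω) (σ n ω) f (X u ω)) ∂P = 0

/-- `K n ω x` is the conditional law of the observation `Y (n + 1)`, made at time `t (n + 1)`, given
the state up to that time and the earlier observations, when the state at that time is `x`; it
depends on `ω` through the earlier observations `Y 1, …, Y n` only. -/
def HasObsLaw (P : Measure Ω) (t : ℕ → ℝ) (X : ℝ → Ω → Vec p) (Y : ℕ → Ω → Vec q)
    (K : ℕ → Ω → Vec p → Measure (Vec q)) : Prop :=
  (∀ n ω x, IsProbabilityMeasure (K n ω x)) ∧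
  (∀ n, ∀ s : Set (Vec q), MeasurableSet s →
    Measurable[(obsSigma Y n).prod inferInstance] fun z : Ω × Vec p => K n z.1 z.2 s) ∧
  ∀ n, ∀ s : Set (Vec q), MeasurableSet s →
    P⟦Y (n + 1) ⁻¹' s | stateSigma X (t (n + 1)) ⊔ obsSigma Y n⟧
      =ᵐ[P] fun ω => (K n ω (X (t (n + 1)) ω)).real s

/-- `X` is a diffusion observed at the times `t 1 < t 2 < …`, and `(X, Y)` follows the filtering
model `S n` on `[t n, t (n + 1)]`: the state equation has coefficients `b`, `σ`; given the past, the
observation `Y (n + 1)` is centered at `ψ(X)`, with covariance tensor `β(ψ(X))`; and the initial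
state is centered at `m₀` with covariance tensor `C₀`. -/
structure IsFilteringSystem (P : Measure Ω) (t : ℕ → ℝ) (X : ℝ → Ω → Vec p)
    (Y : ℕ → Ω → Vec q) (S : ℕ → Ω → Model p q) (m₀ : Vec p) (C₀ : Mat p p) : Prop where
  X_meas : ∀ r, 0 ≤ r → Measurable (X r)
  X_cont : ∀ ω, ContinuousOn (fun r => X r ω) (Ici 0)
  Y_meas : ∀ n, Measurable (Y n)
  admissible : ∀ n ω, (S n ω).IsAdmissible
  b_adapted : ∀ n x, Measurable[obsSigma Y n] fun ω => (S n ω).b x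
  σ_adapted : ∀ n x i j, Measurable[obsSigma Y n] fun ω => (S n ω).σ x i j
  ψ_adapted : ∀ n x, Measurable[obsSigma Y n] fun ω => (S n ω).ψ x
  β_adapted : ∀ n y i j, Measurable[obsSigma Y n] fun ω => (S n ω).β y i j
  initial : ∀ ω, IsCenteredAt (S 0 ω).stateConn (P.map (X 0)) m₀ C₀
  state : IsDiffusion P t X Y (fun n ω => (S n ω).b) (fun n ω => (S n ω).σ)
  obs : ∃ K, HasObsLaw P t X Y K ∧ ∀ n ω x,
    IsCenteredAt (S n ω).obsConn (K n ω x) ((S n ω).ψ x) ((S n ω).β ((S n ω).ψ x))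

/-! ### The linear Gaussian system and the Kalman filter -/

/-- The Gaussian law (possibly degenerate) with mean `m` and covariance matrix `C`. -/
def IsNormal {n : ℕ} (ν : Measure (Vec n)) (m : Vec n) (C : Mat n n) : Prop :=
  IsGaussian ν ∧ (∀ i, ∫ x, x i ∂ν = m i) ∧
    ∀ i j, ∫ x, (x i - m i) * (x j - m j) ∂ν = C i j

/-- `X` is an Ornstein-Uhlenbeck process, `dX = A n X dt + σ n dW` on `[t n, t (n + 1)]`, with
initial law `N(m₀, C₀)`, and `Y (n + 1) = J n X + V (n + 1)` at time `t (n + 1)`, where, given the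
state up to that time and the earlier observations, `V (n + 1)` has law `N(0, B n)`; the matrices
`A n`, `σ n`, `J n`, `B n` are measurable with respect to `Y 1, …, Y n`. -/
structure IsLinearGaussianSystem (P : Measure Ω) (t : ℕ → ℝ) (X : ℝ → Ω → Vec p)
    (Y : ℕ → Ω → Vec q) (A σ : ℕ → Ω → Mat p p) (J : ℕ → Ω → Mat q p) (B : ℕ → Ω → Mat q q)
    (m₀ : Vec p) (C₀ : Mat p p) : Prop where
  X_meas : ∀ r, 0 ≤ r → Measurable (X r)
  X_cont : ∀ ω, ContinuousOn (fun r => X r ω) (Ici 0)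
  Y_meas : ∀ n, Measurable (Y n)
  A_adapted : ∀ n i j, Measurable[obsSigma Y n] fun ω => A n ω i j
  σ_adapted : ∀ n i j, Measurable[obsSigma Y n] fun ω => σ n ω i j
  J_adapted : ∀ n i j, Measurable[obsSigma Y n] fun ω => J n ω i j
  B_adapted : ∀ n i j, Measurable[obsSigma Y n] fun ω => B n ω i j
  initial : IsNormal (P.map (X 0)) m₀ C₀
  state : IsDiffusion P t X Y (fun n ω x => A n ω *ᵥ x) (fun n ω _ => σ n ω)
  obs : ∃ K, HasObsLaw P t X Y K ∧ ∀ n ω x, IsNormal (K n ω x) (J n ω *ᵥ x) (B n ω)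

end Processes

/-- The filtering model of a linear Gaussian system, with a constant generalized inverse `g` of the
diffusion variance `σ σᵀ`. -/
def linearModel {p q : ℕ} (A σ g : Mat p p) (J : Mat q p) (B : Mat q q) : Model p q where
  b x := A *ᵥ x
  σ _ := σ
  g _ := g
  ψ x := J *ᵥ x
  β _ := B

/-- One cycle of the continuous-discrete Kalman filter for `dX = A X dt + σ dW` over a time `δ`,
followed by the observation `y = J X + V`, `V ∼ N(0, B)`. -/
def kalmanStep {p q : ℕ} (A σ : Mat p p) (J : Mat q p) (B : Mat q q) (δ : ℝ) (y : Vec q)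
    (s : Vec p × Mat p p) : Vec p × Mat p p :=
  let m := NormedSpace.exp (δ • A) *ᵥ s.1
  let C := NormedSpace.exp (δ • A) * s.2 * (NormedSpace.exp (δ • A))ᵀ
    + Matrix.of fun i j => ∫ u in (0 : ℝ)..δ,
        (NormedSpace.exp (u • A) * (σ * σᵀ) * (NormedSpace.exp (u • A))ᵀ) i j
  let G := C * Jᵀ * (J * C * Jᵀ + B)⁻¹
  (m + G *ᵥ (y - J *ᵥ m), (1 - G * J) * C)

/-- The Kalman filter estimates (mean and covariance matrix) after the `n`-th observation. -/
def kalman {p q : ℕ} (t : ℕ → ℝ) (A σ : ℕ → Mat p p) (J : ℕ → Mat q p) (B : ℕ → Mat q q)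
    (y : ℕ → Vec q) (m₀ : Vec p) (C₀ : Mat p p) : ℕ → Vec p × Mat p p
  | 0 => (m₀, C₀)
  | n + 1 => kalmanStep (A n) (σ n) (J n) (B n) (t (n + 1) - t n) (y (n + 1))
      (kalman t A σ J B y m₀ C₀ n)

end GIF

end

open MeasureTheory ProbabilityTheory Set Filter
open scoped Matrix Topology

noncomputable section

namespace GIF

/-! ### Jacobians, second derivatives and contraction with 2-tensors -/

section Calculus

variable {n m k : ℕ}

/-! In the original coordinates every coefficient entering a connector is constant, so state and
observation spaces are flat there: both connectors vanish, geodesics are straight lines, the flow of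
`ξ` is `exp(tA)`, and one cycle of the GI filter is literally a Kalman step. Each ingredient of the
filter is intrinsic, so changing coordinates conjugates the whole recursion by `φ` and `θ`. The
proof makes this explicit for the transformed model instead of developing a general invariance
theory.

Everything rests on identifying the two transformed connectors with `flatConn φ` and `flatConn θ`
(`subRiemannian_pullForm`, `leviCivita_pullForm`). The remaining ingredients follow: the Itô term in
the drift cancels against the connector term in `ξ`, so the flow is `φ ∘ exp(tA) ∘ φ⁻¹` and no other
(`isFlow_map_linearModel_iff`); the flow and the observation function are linear in flat
coordinates, so their second fundamental forms vanish (`secondFundForm_flatConn`) and with them the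
location parameters and the quadratic coefficient; the exponential map is explicit
(`isExp_flatConn`). What is left of the cycle is the gain and the covariances, which transform as
tensors, and `giStep_map_linearModel_iff` reads off the Kalman step.

The delicate point is curvature. For a `C²` diffeomorphism `flatConn φ` is merely continuous, so its
curvature is a weak one. That zero is a curvature amounts to the vanishing integral of a null
Lagrangian for `C¹` functions (`integral_fderiv_fderiv_comm`); continuity makes it the only one.

On the probabilistic side, Itô's formula is the chain rule for generators (`generator_map`),
diffeomorphisms leave the generated sigma-fields unchanged, and the inverse exponential of a
transformed Gaussian variable is a linear function of the original one
(`IsNormal.isCenteredAt_flatConn`). -/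

theorem jac_mulVec (f : Vec n → Vec m) (x v : Vec n) : jac f x *ᵥ v = fderiv ℝ f x v := by
  have h : jac f x = LinearMap.toMatrix' (fderiv ℝ f x).toLinearMap := by
    ext i j
    simp [jac, LinearMap.toMatrix'_apply, basisVec]
  rw [h, LinearMap.toMatrix'_mulVec]
  rfl

theorem jac_eq_of_mulVec {f : Vec n → Vec m} {x : Vec n} {M : Mat m n}
    (h : ∀ v, fderiv ℝ f x v = M *ᵥ v) : jac f x = M := by
  apply Matrix.ext_of_mulVec_single
  intro i
  rw [jac_mulVec, h]

theorem jac_comp {f : Vec m → Vec k} {g : Vec n → Vec m} {x : Vec n}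
    (hf : DifferentiableAt ℝ f (g x)) (hg : DifferentiableAt ℝ g x) :
    jac (f ∘ g) x = jac f (g x) * jac g x :=
  jac_eq_of_mulVec fun v => by
    rw [fderiv_comp x hf hg, ← Matrix.mulVec_mulVec, jac_mulVec, jac_mulVec]
    rfl

theorem jac_mulVec_fun (M : Mat m n) (x : Vec n) : jac (fun z => M *ᵥ z) x = M :=
  jac_eq_of_mulVec fun v => by
    have : (fun z : Vec n => M *ᵥ z) = (Matrix.mulVecLin M).toContinuousLinearMap := rfl
    rw [this, ContinuousLinearMap.fderiv]
    rfl

theorem contDiff_mulVec (M : Mat m n) {r : WithTop ℕ∞} : ContDiff ℝ r fun z : Vec n => M *ᵥ z :=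
  (Matrix.mulVecLin M).toContinuousLinearMap.contDiff

theorem contDiff_jac_apply {f : Vec n → Vec m} (hf : ContDiff ℝ 2 f) (i : Fin m) (j : Fin n) :
    ContDiff ℝ 1 fun x => jac f x i j := by
  have h : ContDiff ℝ 1 fun x => fderiv ℝ f x (basisVec j) :=
    (hf.fderiv_right (m := 1) (by norm_num)).clm_apply contDiff_const
  exact contDiff_pi.1 h i

variable {F : Type*} [NormedAddCommGroup F] [NormedSpace ℝ F]

theorem hess_comm {f : Vec n → F} (hf : ContDiff ℝ 2 f) (x u v : Vec n) :
    hess f x u v = hess f x v u :=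
  (hf.contDiffAt.isSymmSndFDerivAt (by simp)) u v

theorem hasFDerivAt_fderiv {f : Vec n → F} (hf : ContDiff ℝ 2 f) (x : Vec n) :
    HasFDerivAt (fderiv ℝ f) (fderiv ℝ (fderiv ℝ f) x) x :=
  (((hf.fderiv_right (m := 1) (by norm_num)).differentiable (by norm_num)) x).hasFDerivAt

theorem continuous_hess {f : Vec n → F} (hf : ContDiff ℝ 2 f) (u v : Vec n) :
    Continuous fun x => hess f x u v := by
  have h : Continuous (fderiv ℝ (fderiv ℝ f)) :=
    (hf.fderiv_right (m := 1) (by norm_num)).continuous_fderiv (by norm_num)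
  exact (h.clm_apply continuous_const).clm_apply continuous_const

theorem hess_comp {f : Vec m → F} {g : Vec n → Vec m} (hf : ContDiff ℝ 2 f) (hg : ContDiff ℝ 2 g)
    (x u v : Vec n) :
    hess (f ∘ g) x u v
      = hess f (g x) (fderiv ℝ g x u) (fderiv ℝ g x v) + fderiv ℝ f (g x) (hess g x u v) := by
  have h1 : fderiv ℝ (f ∘ g) = fun z => (fderiv ℝ f (g z)).comp (fderiv ℝ g z) := by
    funext z
    exact fderiv_comp z (hf.differentiable (by norm_num) _) (hg.differentiable (by norm_num) _)
  have h2 : HasFDerivAt (fun z => fderiv ℝ f (g z))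
      ((fderiv ℝ (fderiv ℝ f) (g x)).comp (fderiv ℝ g x)) x :=
    (hasFDerivAt_fderiv hf (g x)).comp x ((hg.differentiable (by norm_num)) x).hasFDerivAt
  have h3 := h2.clm_comp (hasFDerivAt_fderiv hg x)
  rw [hess, h1, h3.fderiv]
  simp [hess, add_comm]

theorem hess_mulVec_fun (M : Mat m n) (x u v : Vec n) : hess (fun z => M *ᵥ z) x u v = 0 := by
  have h : fderiv ℝ (fun z : Vec n => M *ᵥ z)
      = fun _ => (Matrix.mulVecLin M).toContinuousLinearMap := by
    funext z
    exact (Matrix.mulVecLin M).toContinuousLinearMap.fderiv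
  rw [hess, h]
  simp

theorem contract_congr {T T' : Vec n → Vec n → F} (h : ∀ u v, T u v = T' u v) (S : Mat n n) :
    contract T S = contract T' S := by
  simp [contract, h]

theorem contract_zero (S : Mat n n) : contract (fun _ _ : Vec n => (0 : F)) S = 0 := by
  simp [contract]

theorem contract_add (T T' : Vec n → Vec n → F) (S : Mat n n) :
    contract (fun u v => T u v + T' u v) S = contract T S + contract T' S := by
  simp [contract, Finset.sum_add_distrib]

theorem contract_clm {F' : Type*} [NormedAddCommGroup F'] [NormedSpace ℝ F'] (L : F →L[ℝ] F')
    (T : Vec n → Vec n → F) (S : Mat n n) :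
    contract (fun u v => L (T u v)) S = L (contract T S) := by
  simp [contract]

theorem vec_eq_sum_basisVec (u : Vec n) : u = ∑ i, u i • basisVec i := by
  ext j
  simp [basisVec, Finset.sum_apply, Pi.single_apply]

/-- The tensor transformation law: expand `M eᵢ` and `M eⱼ` in the basis and reorder the four sums.
It moves Jacobians between the arguments of a bilinear form and the 2-tensor. -/
theorem contract_conj (T : Vec m →L[ℝ] Vec m →L[ℝ] F) (M : Mat m n) (S : Mat n n) :
    contract (fun u v => T (M *ᵥ u) (M *ᵥ v)) S = contract (fun u v => T u v) (M * S * Mᵀ) := by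
  have h : ∀ i j, T (M *ᵥ basisVec i) (M *ᵥ basisVec j)
      = ∑ a, ∑ b, (M a i * M b j) • T (basisVec a) (basisVec b) := by
    intro i j
    conv_lhs => rw [vec_eq_sum_basisVec (M *ᵥ basisVec i), vec_eq_sum_basisVec (M *ᵥ basisVec j)]
    simp only [map_sum, map_smul, _root_.sum_apply, _root_.smul_apply,
      Finset.smul_sum, smul_smul]
    rw [Finset.sum_comm]
    refine Finset.sum_congr rfl fun a _ => Finset.sum_congr rfl fun b _ => ?_
    simp [basisVec, mul_comm]
  simp only [contract, h, Finset.smul_sum, smul_smul]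
  have h2 : ∀ a b, (M * S * Mᵀ) a b = ∑ i, ∑ j, S i j * (M a i * M b j) := by
    intro a b
    simp only [Matrix.mul_apply, Matrix.transpose_apply, Finset.sum_mul]
    rw [Finset.sum_comm]
    refine Finset.sum_congr rfl fun i _ => Finset.sum_congr rfl fun j _ => by ring
  simp only [h2, Finset.sum_smul]
  calc _ = ∑ i, ∑ a, ∑ j, ∑ b, (S i j * (M a i * M b j)) • T (basisVec a) (basisVec b) :=
        Finset.sum_congr rfl fun i _ => Finset.sum_comm
    _ = ∑ a, ∑ i, ∑ j, ∑ b, (S i j * (M a i * M b j)) • T (basisVec a) (basisVec b) :=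
        Finset.sum_comm
    _ = ∑ a, ∑ i, ∑ b, ∑ j, (S i j * (M a i * M b j)) • T (basisVec a) (basisVec b) :=
        Finset.sum_congr rfl fun a _ => Finset.sum_congr rfl fun i _ => Finset.sum_comm
    _ = _ := Finset.sum_congr rfl fun a _ => Finset.sum_comm

end Calculus

/-! ### Diffeomorphisms of class `C²` -/

section Diffeo

variable {n : ℕ} {φ : Vec n ≃ Vec n}

theorem fderiv_symm_fderiv (hφ : ContDiff ℝ 2 φ) (hφ' : ContDiff ℝ 2 φ.symm) (x v : Vec n) :
    fderiv ℝ φ.symm (φ x) (fderiv ℝ φ x v) = v := by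
  have h := fderiv_comp x (hφ'.differentiable (by norm_num) (φ x))
    (hφ.differentiable (by norm_num) x)
  have h2 : (φ.symm ∘ φ : Vec n → Vec n) = id := by funext z; simp
  rw [h2, fderiv_id] at h
  exact (DFunLike.congr_fun h v).symm

theorem fderiv_fderiv_symm (hφ : ContDiff ℝ 2 φ) (hφ' : ContDiff ℝ 2 φ.symm) (y v : Vec n) :
    fderiv ℝ φ (φ.symm y) (fderiv ℝ φ.symm y v) = v :=
  fderiv_symm_fderiv (φ := φ.symm) hφ' hφ y v

theorem fderiv_symm_fderiv_symm (hφ : ContDiff ℝ 2 φ) (hφ' : ContDiff ℝ 2 φ.symm) (y v : Vec n) :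
    fderiv ℝ φ.symm y (fderiv ℝ φ (φ.symm y) v) = v := by
  have h := fderiv_symm_fderiv hφ hφ' (φ.symm y) v
  rwa [φ.apply_symm_apply] at h

theorem jac_symm_mul_jac (hφ : ContDiff ℝ 2 φ) (hφ' : ContDiff ℝ 2 φ.symm) (x : Vec n) :
    jac φ.symm (φ x) * jac φ x = 1 := by
  apply Matrix.ext_of_mulVec_single
  intro i
  rw [← Matrix.mulVec_mulVec, jac_mulVec, jac_mulVec, fderiv_symm_fderiv hφ hφ', Matrix.one_mulVec]

theorem jac_mul_jac_symm (hφ : ContDiff ℝ 2 φ) (hφ' : ContDiff ℝ 2 φ.symm) (x : Vec n) :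
    jac φ x * jac φ.symm (φ x) = 1 :=
  mul_eq_one_comm.1 (jac_symm_mul_jac hφ hφ' x)

theorem jac_inv (hφ : ContDiff ℝ 2 φ) (hφ' : ContDiff ℝ 2 φ.symm) (x : Vec n) :
    (jac φ x)⁻¹ = jac φ.symm (φ x) :=
  Matrix.inv_eq_left_inv (jac_symm_mul_jac hφ hφ' x)

theorem jac_symm_inv (hφ : ContDiff ℝ 2 φ) (hφ' : ContDiff ℝ 2 φ.symm) (x : Vec n) :
    (jac φ.symm (φ x))⁻¹ = jac φ x :=
  Matrix.inv_eq_left_inv (jac_mul_jac_symm hφ hφ' x)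

theorem isUnit_jac (hφ : ContDiff ℝ 2 φ) (hφ' : ContDiff ℝ 2 φ.symm) (x : Vec n) :
    IsUnit (jac φ x) :=
  ⟨⟨_, _, jac_mul_jac_symm hφ hφ' x, jac_symm_mul_jac hφ hφ' x⟩, rfl⟩

/-- The left side is the second derivative of `φ⁻¹ ∘ φ`, which is the identity. -/
theorem hess_symm_add (hφ : ContDiff ℝ 2 φ) (hφ' : ContDiff ℝ 2 φ.symm) (x u v : Vec n) :
    hess φ.symm (φ x) (fderiv ℝ φ x u) (fderiv ℝ φ x v) + fderiv ℝ φ.symm (φ x) (hess φ x u v)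
      = 0 := by
  rw [← hess_comp hφ' hφ]
  have h2 : (φ.symm ∘ φ : Vec n → Vec n) = fun z => (1 : Mat n n) *ᵥ z := by funext z; simp
  rw [h2, hess_mulVec_fun]

/-- The connector of the connection that is flat in the coordinates `φ⁻¹`. -/
def flatConn (φ : Vec n ≃ Vec n) : Connector n := fun y u v =>
  fderiv ℝ φ (φ.symm y) (hess φ.symm y u v)

/-- The source of all later cancellations: on vectors carried over by `φ`, the connector is exactly
opposite to the second derivative of `φ`. -/
theorem flatConn_fderiv (hφ : ContDiff ℝ 2 φ) (hφ' : ContDiff ℝ 2 φ.symm) (x u v : Vec n) :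
    flatConn φ (φ x) (fderiv ℝ φ x u) (fderiv ℝ φ x v) = - hess φ x u v := by
  have h := fderiv_fderiv_symm hφ hφ' (φ x) (hess φ x u v)
  rw [flatConn, eq_neg_of_add_eq_zero_left (hess_symm_add hφ hφ' x u v), map_neg, h]

end Diffeo

/-! ### Identification of the transformed connectors; their second fundamental forms and geodesics
-/

section FlatConnectors

variable {n : ℕ} {φ : Vec n ≃ Vec n}

/-- The field of bilinear forms on the target of `φ` that has the constant matrix `G` in the
coordinates `φ⁻¹`. -/
def pullForm (φ : Vec n ≃ Vec n) (G : Mat n n) (y : Vec n) : Mat n n :=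
  (jac φ.symm y)ᵀ * G * jac φ.symm y

theorem dotProduct_pullForm (G : Mat n n) (y u v : Vec n) :
    u ⬝ᵥ pullForm φ G y *ᵥ v = fderiv ℝ φ.symm y u ⬝ᵥ G *ᵥ fderiv ℝ φ.symm y v := by
  rw [← jac_mulVec, ← jac_mulVec, pullForm, ← Matrix.mulVec_mulVec, ← Matrix.mulVec_mulVec,
    Matrix.dotProduct_mulVec, Matrix.vecMul_transpose]

theorem dotProduct_mulVec_comm {G : Mat n n} (hG : Gᵀ = G) (u v : Vec n) :
    u ⬝ᵥ G *ᵥ v = v ⬝ᵥ G *ᵥ u := by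
  rw [Matrix.dotProduct_mulVec, ← Matrix.mulVec_transpose, hG, dotProduct_comm]

/-- Product rule with `G` constant: only the two factors `Dφ⁻¹` are differentiated. -/
theorem fderiv_dotProduct_pullForm (hφ' : ContDiff ℝ 2 φ.symm) (G : Mat n n) (y u v w : Vec n) :
    fderiv ℝ (fun z => v ⬝ᵥ pullForm φ G z *ᵥ w) y u
      = fderiv ℝ φ.symm y v ⬝ᵥ G *ᵥ hess φ.symm y u w
        + hess φ.symm y u v ⬝ᵥ G *ᵥ fderiv ℝ φ.symm y w := by
  have hB : ∀ a b : Vec n, a ⬝ᵥ G *ᵥ b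
      = (Matrix.toLinearMap₂' ℝ G).toContinuousBilinearMap a b := fun a b => by
    rw [LinearMap.toContinuousBilinearMap_apply, Matrix.toLinearMap₂'_apply']
  have h : ∀ a, HasFDerivAt (fun z => fderiv ℝ φ.symm z a)
      ((fderiv ℝ (fderiv ℝ φ.symm) y).flip a) y := fun a => by
    have := (hasFDerivAt_fderiv hφ' y).clm_apply (hasFDerivAt_const a y)
    simpa using this
  simp only [dotProduct_pullForm, hB]
  rw [((Matrix.toLinearMap₂' ℝ G).toContinuousBilinearMap.hasFDerivAt_of_bilinear
    (h v) (h w)).fderiv]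
  simp [hess]

/-- Of the six product-rule terms, four cancel in pairs by symmetry of the second derivative and of
`G`; the other two coincide. `G` may be degenerate, as it must be for the form `g α g`. -/
theorem koszul_pullForm (hφ' : ContDiff ℝ 2 φ.symm) {G : Mat n n} (hG : Gᵀ = G)
    (y u v w : Vec n) :
    koszul (pullForm φ G) y u v w = 2 * (hess φ.symm y u v ⬝ᵥ G *ᵥ fderiv ℝ φ.symm y w) := by
  simp only [koszul, fderiv_dotProduct_pullForm hφ']
  rw [dotProduct_mulVec_comm hG (hess φ.symm y v w), dotProduct_mulVec_comm hG (hess φ.symm y w u),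
    dotProduct_mulVec_comm hG (fderiv ℝ φ.symm y w) (hess φ.symm y v u), hess_comm hφ' y v u,
    hess_comm hφ' y w u, hess_comm hφ' y w v]
  ring

/-- Raising the index: the covector on the left is the metric `pullForm φ G y` applied to `Dφ h`. -/
theorem pullForm_inv_mulVec (hφ : ContDiff ℝ 2 φ) (hφ' : ContDiff ℝ 2 φ.symm) {G : Mat n n}
    (hG : Gᵀ = G) (hGu : IsUnit G) (y h : Vec n) :
    ((pullForm φ G y)⁻¹ *ᵥ fun k => h ⬝ᵥ G *ᵥ fderiv ℝ φ.symm y (basisVec k))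
      = fderiv ℝ φ (φ.symm y) h := by
  have h1 : (fun k => h ⬝ᵥ G *ᵥ fderiv ℝ φ.symm y (basisVec k))
      = pullForm φ G y *ᵥ (jac φ (φ.symm y) *ᵥ h) := by
    funext k
    have h2 := dotProduct_pullForm (φ := φ) G y (basisVec k) (jac φ (φ.symm y) *ᵥ h)
    rw [jac_mulVec, fderiv_symm_fderiv_symm hφ hφ'] at h2
    rw [jac_mulVec, dotProduct_mulVec_comm hG, ← h2]
    simp [basisVec]
  have h3 : IsUnit (pullForm φ G y) := by
    have := isUnit_jac (φ := φ.symm) hφ' hφ y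
    exact (((Matrix.isUnit_transpose _).2 this).mul hGu).mul this
  rw [h1, Matrix.mulVec_mulVec, Matrix.nonsing_inv_mul _ ((Matrix.isUnit_iff_isUnit_det _).1 h3),
    Matrix.one_mulVec, jac_mulVec]

theorem leviCivita_pullForm (hφ : ContDiff ℝ 2 φ) (hφ' : ContDiff ℝ 2 φ.symm) {G : Mat n n}
    (hG : Gᵀ = G) (hGu : IsUnit G) : leviCivita (pullForm φ G) = flatConn φ := by
  funext y u v
  simp only [leviCivita, koszul_pullForm hφ' hG]
  rw [flatConn, ← pullForm_inv_mulVec hφ hφ' hG hGu]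
  congr 1
  funext k
  ring

/-- The two Koszul terms give `G a G` and `G (1 - a G)` paired with the same Hessian vector, and
these matrices add up to `G`. Thus the correction term supplies precisely what a degenerate `a`
loses, and the answer does not depend on `a`. -/
theorem subRiemannian_pullForm (hφ : ContDiff ℝ 2 φ) (hφ' : ContDiff ℝ 2 φ.symm) {a G : Mat n n}
    (ha : aᵀ = a) (hG : Gᵀ = G) (hGu : IsUnit G) :
    subRiemannian (fun y => jac φ (φ.symm y) * a * (jac φ (φ.symm y))ᵀ) (pullForm φ G)
      = flatConn φ := by
  have hEG : ∀ y, jac φ.symm y * jac φ (φ.symm y) = 1 := fun y => by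
    have := jac_symm_mul_jac hφ hφ' (φ.symm y)
    rwa [φ.apply_symm_apply] at this
  have hGE : ∀ y, (jac φ (φ.symm y))ᵀ * (jac φ.symm y)ᵀ = 1 := fun y => by
    rw [← Matrix.transpose_mul, hEG, Matrix.transpose_one]
  have h1 : (fun y => pullForm φ G y * (jac φ (φ.symm y) * a * (jac φ (φ.symm y))ᵀ)
      * pullForm φ G y) = pullForm φ (G * a * G) := by
    funext y
    simp only [pullForm]
    calc _ = (jac φ.symm y)ᵀ * G * (jac φ.symm y * jac φ (φ.symm y)) * a
          * ((jac φ (φ.symm y))ᵀ * (jac φ.symm y)ᵀ) * G * jac φ.symm y := by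
          simp only [Matrix.mul_assoc]
      _ = _ := by rw [hEG, hGE]; simp only [Matrix.mul_assoc, Matrix.mul_one]
  have h2 : ∀ y w, fderiv ℝ φ.symm y ((1 - jac φ (φ.symm y) * a * (jac φ (φ.symm y))ᵀ
      * pullForm φ G y) *ᵥ w) = (1 - a * G) *ᵥ fderiv ℝ φ.symm y w := fun y w => by
    rw [← jac_mulVec, ← jac_mulVec, Matrix.mulVec_mulVec, Matrix.mulVec_mulVec]
    congr 1
    rw [Matrix.mul_sub, Matrix.sub_mul, Matrix.mul_one, Matrix.one_mul]
    congr 1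
    simp only [pullForm]
    calc _ = (jac φ.symm y * jac φ (φ.symm y)) * a
          * ((jac φ (φ.symm y))ᵀ * (jac φ.symm y)ᵀ) * G * jac φ.symm y := by
          simp only [Matrix.mul_assoc]
      _ = _ := by rw [hEG, hGE]; simp only [Matrix.mul_assoc, Matrix.mul_one, Matrix.one_mul]
  have h3 : (G * a * G)ᵀ = G * a * G := by
    simp only [Matrix.transpose_mul, ha, hG, Matrix.mul_assoc]
  funext y u v
  simp only [subRiemannian, h1, koszul_pullForm hφ' h3, koszul_pullForm hφ' hG, h2]
  rw [flatConn, ← pullForm_inv_mulVec hφ hφ' hG hGu]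
  congr 1
  funext k
  rw [Matrix.sub_mulVec, Matrix.one_mulVec, Matrix.mulVec_sub, Matrix.mulVec_mulVec,
    dotProduct_sub, ← Matrix.mul_assoc]
  ring

/-- In flat coordinates the map is `L`, hence affine. Concretely, the Hessian of the composite has
one part from `θ` and one from `φ⁻¹`, and each is removed by the connector on its own side. -/
theorem secondFundForm_flatConn {m : ℕ} {θ : Vec m ≃ Vec m} (hφ : ContDiff ℝ 2 φ)
    (hφ' : ContDiff ℝ 2 φ.symm) (hθ : ContDiff ℝ 2 θ) (hθ' : ContDiff ℝ 2 θ.symm) (L : Mat m n)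
    (y u v : Vec n) :
    secondFundForm (flatConn φ) (flatConn θ) (fun z => θ (L *ᵥ φ.symm z)) y u v = 0 := by
  have hL : ContDiff ℝ 2 fun z => L *ᵥ φ.symm z := (contDiff_mulVec L).comp hφ'
  have hf : ∀ w, fderiv ℝ (fun z => θ (L *ᵥ φ.symm z)) y w
      = fderiv ℝ θ (L *ᵥ φ.symm y) (L *ᵥ fderiv ℝ φ.symm y w) := fun w => by
    have h1 := jac_comp (f := θ) (g := fun z => L *ᵥ φ.symm z) (x := y)
      (hθ.differentiable (by norm_num) _) (hL.differentiable (by norm_num) _)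
    have h2 := jac_comp (f := fun z => L *ᵥ z) (g := φ.symm) (x := y)
      ((contDiff_mulVec L (r := 2)).differentiable (by norm_num) _)
      (hφ'.differentiable (by norm_num) _)
    simp only [Function.comp_def] at h1 h2
    rw [← jac_mulVec, h1, h2, jac_mulVec_fun, ← Matrix.mulVec_mulVec, ← Matrix.mulVec_mulVec,
      jac_mulVec, jac_mulVec]
  have hL1 : ∀ w, fderiv ℝ (fun z => L *ᵥ φ.symm z) y w = L *ᵥ fderiv ℝ φ.symm y w := fun w => by
    have h2 := jac_comp (f := fun z => L *ᵥ z) (g := φ.symm) (x := y)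
      ((contDiff_mulVec L (r := 2)).differentiable (by norm_num) _)
      (hφ'.differentiable (by norm_num) _)
    simp only [Function.comp_def] at h2
    rw [← jac_mulVec, h2, jac_mulVec_fun, ← Matrix.mulVec_mulVec, jac_mulVec]
  have h3 := hess_comp hθ hL y u v
  have h4 := hess_comp (contDiff_mulVec L (r := 2)) hφ' y u v
  rw [hess_mulVec_fun, zero_add, ← jac_mulVec, jac_mulVec_fun] at h4
  simp only [Function.comp_def] at h3 h4
  simp only [secondFundForm, jac_mulVec]
  rw [hf, hf, hf, flatConn_fderiv hθ hθ', h3, h4, hL1, hL1, flatConn]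
  rw [fderiv_symm_fderiv_symm hφ hφ']
  abel

theorem hasDerivWithinAt_fderiv_apply {m : ℕ} {f : Vec n → Vec m} (hf : ContDiff ℝ 2 f)
    {c ζ : ℝ → Vec n} {c' ζ' : Vec n} {s : ℝ} {I : Set ℝ} (hc : HasDerivWithinAt c c' I s)
    (hζ : HasDerivWithinAt ζ ζ' I s) :
    HasDerivWithinAt (fun r => fderiv ℝ f (c r) (ζ r))
      (hess f (c s) c' (ζ s) + fderiv ℝ f (c s) ζ') I s :=
  ((hasFDerivAt_fderiv hf (c s)).comp_hasDerivWithinAt s hc).clm_apply hζ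

/-- In the coordinates `φ⁻¹` geodesics are straight lines. Since the connector is only continuous,
uniqueness is not taken from ODE theory: the velocity of `φ⁻¹ ∘ c` has zero derivative, and so does
`φ⁻¹ ∘ c` minus the resulting line. -/
theorem isExp_flatConn (hφ : ContDiff ℝ 2 φ) (hφ' : ContDiff ℝ 2 φ.symm) (x v y : Vec n) :
    IsExp (flatConn φ) x v y ↔ y = φ (φ.symm x + fderiv ℝ φ.symm x v) := by
  constructor
  · rintro ⟨c, ζ, hc0, hζ0, hc1, h⟩
    have hd : ∀ s ∈ Icc (0 : ℝ) 1, HasDerivWithinAt (fun s => φ.symm (c s))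
        (fderiv ℝ φ.symm (c s) (ζ s)) (Icc 0 1) s := fun s hs =>
      ((hφ'.differentiable (by norm_num)) (c s)).hasFDerivAt.comp_hasDerivWithinAt s (h s hs).1
    have hd2 : ∀ s ∈ Icc (0 : ℝ) 1, HasDerivWithinAt (fun s => fderiv ℝ φ.symm (c s) (ζ s))
        0 (Icc 0 1) s := fun s hs => by
      refine (hasDerivWithinAt_fderiv_apply hφ' (h s hs).1 (h s hs).2).congr_deriv ?_
      rw [flatConn, map_neg, fderiv_symm_fderiv_symm hφ hφ', add_neg_cancel]
    have hconst : ∀ s ∈ Icc (0 : ℝ) 1, fderiv ℝ φ.symm (c s) (ζ s) = fderiv ℝ φ.symm x v := by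
      intro s hs
      have := constant_of_has_deriv_right_zero (f := fun s => fderiv ℝ φ.symm (c s) (ζ s))
        (a := 0) (b := 1) (fun s hs => (hd2 s hs).continuousWithinAt)
        (fun s hs => (hd2 s ⟨hs.1, hs.2.le⟩).mono_of_mem_nhdsWithin (Icc_mem_nhdsGE_of_mem hs)) s hs
      rw [this, hc0, hζ0]
    have hline : ∀ s ∈ Icc (0 : ℝ) 1, HasDerivWithinAt
        (fun s => φ.symm (c s) - s • fderiv ℝ φ.symm x v) 0 (Icc 0 1) s := fun s hs => by
      have h1 := (hd s hs).sub
        ((hasDerivAt_id s).smul_const (fderiv ℝ φ.symm x v)).hasDerivWithinAt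
      rw [hconst s hs, one_smul, sub_self] at h1
      exact h1
    have := constant_of_has_deriv_right_zero
      (f := fun s => φ.symm (c s) - s • fderiv ℝ φ.symm x v)
      (a := 0) (b := 1) (fun s hs => (hline s hs).continuousWithinAt)
      (fun s hs => (hline s ⟨hs.1, hs.2.le⟩).mono_of_mem_nhdsWithin (Icc_mem_nhdsGE_of_mem hs))
      1 ⟨zero_le_one, le_rfl⟩
    simp only [hc0, hc1, one_smul, zero_smul, sub_zero] at this
    rw [← this]
    simp
  · rintro rfl
    set w := fderiv ℝ φ.symm x v with hw
    have hl : ∀ s : ℝ, HasDerivAt (fun s : ℝ => φ.symm x + s • w) w s := fun s => by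
      simpa using ((hasDerivAt_id s).smul_const w).const_add (φ.symm x)
    refine ⟨fun s => φ (φ.symm x + s • w), fun s => fderiv ℝ φ (φ.symm x + s • w) w, by simp, ?_,
      by simp, fun s _ => ⟨?_, ?_⟩⟩
    · simp only [zero_smul, add_zero, hw]
      exact fderiv_fderiv_symm hφ hφ' x v
    · exact (((hφ.differentiable (by norm_num)) _).hasFDerivAt.comp_hasDerivAt s
        (hl s)).hasDerivWithinAt
    · refine (hasDerivWithinAt_fderiv_apply hφ (hl s).hasDerivWithinAt
        (hasDerivAt_const s w).hasDerivWithinAt).congr_deriv ?_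
      rw [flatConn_fderiv hφ hφ', neg_neg, map_zero, add_zero]

end FlatConnectors

/-! ### Differentiation under the integral sign with uniformly compact support -/

section ParametricIntegral

variable {V W : Type*} [NormedAddCommGroup V] [MeasurableSpace V]
  [BorelSpace V] [NormedAddCommGroup W] [NormedSpace ℝ W] {μ : Measure V}
  [IsFiniteMeasureOnCompacts μ]

/-- The dominating function is a constant on `K` and zero off it; the constant exists because `Ψ'`
is continuous on the compact product of the parameter ball with `K`. -/
theorem hasDerivAt_integral_of_isCompact {Ψ Ψ' : ℝ → V → W} {K : Set V} (hK : IsCompact K)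
    (hΨ : ∀ s x, HasDerivAt (fun r => Ψ r x) (Ψ' s x) s) (hcont : ∀ s, Continuous (Ψ s))
    (hcont' : Continuous fun z : ℝ × V => Ψ' z.1 z.2)
    (hsupp : ∀ s ∈ Metric.closedBall (0 : ℝ) 1, ∀ x ∉ K, Ψ s x = 0 ∧ Ψ' s x = 0) :
    HasDerivAt (fun s => ∫ x, Ψ s x ∂μ) (∫ x, Ψ' 0 x ∂μ) 0 := by
  have h0 : (0 : ℝ) ∈ Metric.closedBall (0 : ℝ) 1 := Metric.mem_closedBall_self zero_le_one
  obtain ⟨c, hc⟩ := ((isCompact_closedBall (0 : ℝ) 1).prod hK).exists_bound_of_continuousOn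
    hcont'.continuousOn
  have hcs : ∀ f : V → W, (∀ x ∉ K, f x = 0) → HasCompactSupport f := fun f hf =>
    HasCompactSupport.intro hK hf
  have hc0 : Continuous (Ψ' 0) := hcont'.comp (Continuous.prodMk_right 0)
  have hint : Integrable (Ψ 0) μ :=
    (hcont 0).integrable_of_hasCompactSupport (hcs _ fun x hx => (hsupp 0 h0 x hx).1)
  have hbint : Integrable (K.indicator fun _ => c) μ :=
    (integrable_indicator_iff hK.measurableSet).2
      (integrableOn_const (hK.measure_lt_top.ne))
  have hmeas : AEStronglyMeasurable (Ψ' 0) μ :=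
    (hc0.integrable_of_hasCompactSupport
      (hcs _ fun x hx => (hsupp 0 h0 x hx).2)).aestronglyMeasurable
  have hmeas' : ∀ᶠ s in 𝓝 (0 : ℝ), AEStronglyMeasurable (Ψ s) μ := by
    filter_upwards [Metric.closedBall_mem_nhds (0 : ℝ) one_pos] with s hs
    exact ((hcont s).integrable_of_hasCompactSupport
      (hcs _ fun x hx => (hsupp s hs x hx).1)).aestronglyMeasurable
  refine (hasDerivAt_integral_of_dominated_loc_of_deriv_le
    (Metric.closedBall_mem_nhds (0 : ℝ) one_pos) hmeas' hint hmeas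
    (.of_forall fun x s hs => ?_) hbint (.of_forall fun x s _ => hΨ s x)).2
  by_cases hx : x ∈ K
  · rw [indicator_of_mem hx]
    exact hc (s, x) ⟨hs, hx⟩
  · rw [indicator_of_notMem hx, (hsupp s hs x hx).2, norm_zero]

end ParametricIntegral

/-! ### A null Lagrangian for functions of class `C¹` -/

section NullLagrangian

variable {V E E' W : Type*} [NormedAddCommGroup V] [NormedSpace ℝ V] [FiniteDimensional ℝ V]
  [MeasurableSpace V] [BorelSpace V] {μ : Measure V} [μ.IsAddHaarMeasure]
  [NormedAddCommGroup E] [NormedSpace ℝ E] [NormedAddCommGroup E'] [NormedSpace ℝ E']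
  [NormedAddCommGroup W] [NormedSpace ℝ W]

/-- The bilinear null Lagrangian `∂_ζ F · ∂_η e - ∂_η F · ∂_ζ e` has vanishing integral, for
functions that are merely of class `C¹`. -/
theorem integral_fderiv_fderiv_comm (L : E →L[ℝ] E' →L[ℝ] W) {F : V → E} {e : V → E'}
    (hF : ContDiff ℝ 1 F) (hFc : HasCompactSupport F) (he : ContDiff ℝ 1 e) (ζ η : V) :
    ∫ x, L (fderiv ℝ F x ζ) (fderiv ℝ e x η) ∂μ = ∫ x, L (fderiv ℝ F x η) (fderiv ℝ e x ζ) ∂μ := by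
  have hFd : Differentiable ℝ F := hF.differentiable (by norm_num)
  have hed : Differentiable ℝ e := he.differentiable (by norm_num)
  have hF' : ∀ v, Continuous fun x => fderiv ℝ F x v := fun v =>
    (hF.continuous_fderiv (by norm_num)).clm_apply continuous_const
  have he' : ∀ v, Continuous fun x => fderiv ℝ e x v := fun v =>
    (he.continuous_fderiv (by norm_num)).clm_apply continuous_const
  have hFz : ∀ x ∉ tsupport F, F x = 0 := fun x hx => image_eq_zero_of_notMem_tsupport hx
  have hFz' : ∀ x ∉ tsupport F, fderiv ℝ F x = 0 := fun x hx => by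
    have : x ∉ tsupport (fderiv ℝ F) := fun h => hx (tsupport_fderiv_subset ℝ h)
    exact image_eq_zero_of_notMem_tsupport this
  have hsh : ∀ s x, HasDerivAt (fun r : ℝ => F (x + r • ζ)) (fderiv ℝ F (x + s • ζ) ζ) s := by
    intro s x
    have h1 : HasDerivAt (fun r : ℝ => x + r • ζ) ζ s := by
      simpa using ((hasDerivAt_id s).smul_const ζ).const_add x
    exact (hFd _).hasFDerivAt.comp_hasDerivAt s h1
  have hsh' : ∀ s x, HasDerivAt (fun r : ℝ => e (x - r • ζ)) (-fderiv ℝ e (x - s • ζ) ζ) s := by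
    intro s x
    have h1 : HasDerivAt (fun r : ℝ => x - r • ζ) (-ζ) s := by
      simpa using ((hasDerivAt_id s).smul_const ζ).const_sub x
    have h2 := (hed (x - s • ζ)).hasFDerivAt.comp_hasDerivAt s h1
    rw [map_neg] at h2
    exact h2
  have hFs : ∀ (s : ℝ) x, HasFDerivAt (fun x => F (x + s • ζ)) (fderiv ℝ F (x + s • ζ)) x :=
    fun s x => by
      have := (hFd (x + s • ζ)).hasFDerivAt.comp x ((hasFDerivAt_id x).add_const (s • ζ))
      rw [ContinuousLinearMap.comp_id] at this
      exact this
  have hcs : ∀ s : ℝ, HasCompactSupport fun x => F (x + s • ζ) := fun s =>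
    hFc.comp_homeomorph (Homeomorph.addRight (s • ζ))
  have hcs' : ∀ s : ℝ, HasCompactSupport fun x => fderiv ℝ F (x + s • ζ) η := fun s =>
    ((hFc.fderiv_apply ℝ η)).comp_homeomorph (Homeomorph.addRight (s • ζ))
  -- Second derivatives are not available, so the derivative along `ζ` is replaced by a translation
  -- by `s • ζ`. Integration by parts along `η`, then translation invariance of the measure, move
  -- the derivative onto `F` and the shift onto `e`. Differentiating both sides at `s = 0` gives the
  -- claim.
  have hkey : ∀ s : ℝ, ∫ x, L (F (x + s • ζ)) (fderiv ℝ e x η) ∂μ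
      = -∫ x, L (fderiv ℝ F x η) (e (x - s • ζ)) ∂μ := by
    intro s
    have hc1 : Continuous fun x : V => x + s • ζ := by fun_prop
    rw [integral_bilinear_hasFDerivAt_right_eq_neg_left_of_integrable (v := η)
      (f := fun x => F (x + s • ζ)) (f' := fun x => fderiv ℝ F (x + s • ζ))
      (g := e) (g' := fderiv ℝ e) (B := L)]
    · congr 1
      rw [← integral_sub_right_eq_self _ (s • ζ)]
      simp
    · refine Continuous.integrable_of_hasCompactSupport ?_ ?_
      · exact (L.continuous.comp ((hF' η).comp hc1)).clm_apply he.continuous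
      · refine (hcs' s).mono fun x hx => ?_
        contrapose! hx
        simp only [Function.mem_support, not_not] at hx ⊢
        simp [hx]
    · refine Continuous.integrable_of_hasCompactSupport ?_ ?_
      · exact (L.continuous.comp (hF.continuous.comp hc1)).clm_apply (he' η)
      · refine (hcs s).mono fun x hx => ?_
        contrapose! hx
        simp only [Function.mem_support, not_not] at hx ⊢
        simp [hx]
    · refine Continuous.integrable_of_hasCompactSupport ?_ ?_
      · exact (L.continuous.comp (hF.continuous.comp hc1)).clm_apply he.continuous
      · refine (hcs s).mono fun x hx => ?_
        contrapose! hx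
        simp only [Function.mem_support, not_not] at hx ⊢
        simp [hx]
    · exact fun x _ => hFs s x
    · exact fun x _ => (hed x).hasFDerivAt
  have hleft : HasDerivAt (fun s : ℝ => ∫ x, L (F (x + s • ζ)) (fderiv ℝ e x η) ∂μ)
      (∫ x, L (fderiv ℝ F (x + (0 : ℝ) • ζ) ζ) (fderiv ℝ e x η) ∂μ) 0 := by
    -- One compact set containing the supports of all translates of `F` with `|s| ≤ 1`.
    have hK : IsCompact ((fun z : ℝ × V => z.2 - z.1 • ζ) ''
        (Metric.closedBall (0 : ℝ) 1 ×ˢ tsupport F)) :=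
      ((isCompact_closedBall (0 : ℝ) 1).prod hFc).image (by fun_prop)
    refine hasDerivAt_integral_of_isCompact
      (Ψ' := fun s x => L (fderiv ℝ F (x + s • ζ) ζ) (fderiv ℝ e x η)) hK (fun s x => ?_)
      (fun s => ?_) ?_ ?_
    · exact ((L.flip (fderiv ℝ e x η)).hasFDerivAt).comp_hasDerivAt s (hsh s x)
    · exact (L.continuous.comp (hF.continuous.comp (by fun_prop))).clm_apply (he' η)
    · exact (L.continuous.comp ((hF' ζ).comp
        (by fun_prop : Continuous fun z : ℝ × V => z.2 + z.1 • ζ))).clm_apply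
        ((he' η).comp continuous_snd)
    · intro s hs x hx
      have : x + s • ζ ∉ tsupport F := fun h => hx ⟨(s, x + s • ζ), ⟨hs, h⟩, by simp⟩
      simp [hFz _ this, hFz' _ this]
  have hright : HasDerivAt (fun s : ℝ => ∫ x, L (fderiv ℝ F x η) (e (x - s • ζ)) ∂μ)
      (∫ x, L (fderiv ℝ F x η) (-fderiv ℝ e (x - (0 : ℝ) • ζ) ζ) ∂μ) 0 := by
    refine hasDerivAt_integral_of_isCompact
      (Ψ' := fun s x => L (fderiv ℝ F x η) (-fderiv ℝ e (x - s • ζ) ζ)) hFc.isCompact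
      (fun s x => ?_) (fun s => ?_) ?_ ?_
    · exact ((L (fderiv ℝ F x η)).hasFDerivAt).comp_hasDerivAt s (hsh' s x)
    · exact (L.continuous.comp (hF' η)).clm_apply (he.continuous.comp (by fun_prop))
    · exact (L.continuous.comp ((hF' η).comp continuous_snd)).clm_apply ((he' ζ).comp
        (by fun_prop : Continuous fun z : ℝ × V => z.2 - z.1 • ζ)).neg
    · intro s hs x hx
      simp [hFz' _ hx]
  have hu := hleft.unique (hright.neg.congr_of_eventuallyEq (.of_forall hkey))
  simpa [integral_neg] using hu

end NullLagrangian

/-! ### Weak curvature of the flat connector -/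

section Curvature

variable {n : ℕ} {φ : Vec n ≃ Vec n}

theorem contDiff_fderiv_comp_symm (hφ : ContDiff ℝ 2 φ) (hφ' : ContDiff ℝ 2 φ.symm) :
    ContDiff ℝ 1 fun y => fderiv ℝ φ (φ.symm y) :=
  (hφ.fderiv_right (m := 1) (by norm_num)).comp (hφ'.of_le (by norm_num))

/-- The frame `Dφ ∘ φ⁻¹` turns constant vectors into parallel fields of the flat connection. -/
theorem fderiv_fderiv_comp_symm (hφ : ContDiff ℝ 2 φ) (hφ' : ContDiff ℝ 2 φ.symm) (y η w : Vec n) :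
    fderiv ℝ (fun y => fderiv ℝ φ (φ.symm y)) y η w
      = - flatConn φ y η (fderiv ℝ φ (φ.symm y) w) := by
  have h1 : HasFDerivAt (fun y => fderiv ℝ φ (φ.symm y))
      ((fderiv ℝ (fderiv ℝ φ) (φ.symm y)).comp (fderiv ℝ φ.symm y)) y :=
    (hasFDerivAt_fderiv hφ (φ.symm y)).comp y ((hφ'.differentiable (by norm_num)) y).hasFDerivAt
  have h2 := flatConn_fderiv hφ hφ' (φ.symm y) (fderiv ℝ φ.symm y η) w
  rw [φ.apply_symm_apply, fderiv_fderiv_symm hφ hφ'] at h2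
  rw [h1.fderiv, h2, neg_neg]
  rfl

theorem fderiv_fderiv_apply (hφ' : ContDiff ℝ 2 φ.symm) (y η κ : Vec n) :
    fderiv ℝ (fun y => fderiv ℝ φ.symm y κ) y η = hess φ.symm y η κ := by
  have h := (hasFDerivAt_fderiv hφ' y).clm_apply (hasFDerivAt_const κ y)
  rw [h.fderiv]
  simp [hess]

/-- With `M = Dφ ∘ φ⁻¹` and `e = Dφ⁻¹ κ` one has `Γ(u, κ) = M ∂ᵤe`, and parallelism of `M` gives
`∂ᵤ(hM) = (∂ᵤh) M - h Γ(u, M ·)`. The integrand in the weak curvature identity is therefore `∂_ζ(hM)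
∂_η e - ∂_η(hM) ∂_ζ e`, the null Lagrangian of the `C¹` functions `hM` and `e`. -/
theorem isCurvature_flatConn_zero (hφ : ContDiff ℝ 2 φ) (hφ' : ContDiff ℝ 2 φ.symm) :
    IsCurvature (flatConn φ) fun _ _ _ _ => 0 := by
  refine ⟨fun _ _ _ => continuous_const, fun h hh hhc ζ η κ => ?_⟩
  have hh1 : ContDiff ℝ 1 h := hh.of_le (by exact_mod_cast le_top)
  have hM := contDiff_fderiv_comp_symm hφ hφ'
  have hF : ContDiff ℝ 1 fun y => h y • fderiv ℝ φ (φ.symm y) := hh1.smul hM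
  have hFc : HasCompactSupport fun y => h y • fderiv ℝ φ (φ.symm y) := hhc.smul_right
  have he : ContDiff ℝ 1 fun y => fderiv ℝ φ.symm y κ :=
    (hφ'.fderiv_right (m := 1) (by norm_num)).clm_apply contDiff_const
  have hcomm := integral_fderiv_fderiv_comm (μ := volume)
    (ContinuousLinearMap.id ℝ (Vec n →L[ℝ] Vec n)) hF hFc he
  have hFd : ∀ y u w, fderiv ℝ (fun y => h y • fderiv ℝ φ (φ.symm y)) y u w
      = fderiv ℝ h y u • fderiv ℝ φ (φ.symm y) w
        - h y • flatConn φ y u (fderiv ℝ φ (φ.symm y) w) := by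
    intro y u w
    rw [fderiv_fun_smul (hh1.differentiable (by norm_num) y) (hM.differentiable (by norm_num) y)]
    simp only [_root_.add_apply, _root_.smul_apply, ContinuousLinearMap.smulRight_apply,
      fderiv_fderiv_comp_symm hφ hφ', smul_neg]
    abel
  have hint : ∀ u v, Integrable fun y => fderiv ℝ (fun y => h y • fderiv ℝ φ (φ.symm y)) y u
      (fderiv ℝ (fun y => fderiv ℝ φ.symm y κ) y v) := fun u v => by
    refine Continuous.integrable_of_hasCompactSupport ?_ ?_
    · exact ((hF.continuous_fderiv (by norm_num)).clm_apply continuous_const).clm_apply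
        ((he.continuous_fderiv (by norm_num)).clm_apply continuous_const)
    · refine (hFc.fderiv_apply ℝ u).mono fun x hx => ?_
      contrapose! hx
      simp only [Function.mem_support, not_not] at hx ⊢
      simp [hx]
  have hz := sub_eq_zero.2 (hcomm ζ η)
  simp only [ContinuousLinearMap.id_apply] at hz
  rw [← integral_sub (hint ζ η) (hint η ζ)] at hz
  simp only [smul_zero, integral_zero]
  rw [← hz]
  refine integral_congr_ae (.of_forall fun y => ?_)
  simp only [hFd, fderiv_fderiv_apply hφ', flatConn, smul_sub]
  abel

/-- The weak identity fixes a curvature almost everywhere, and continuity then fixes it at every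
point. The filter step admits any such `R`, so uniqueness is needed there. -/
theorem IsCurvature.eq_zero_of_flatConn (hφ : ContDiff ℝ 2 φ) (hφ' : ContDiff ℝ 2 φ.symm)
    {R : Vec n → Vec n → Vec n → Vec n → Vec n} (hR : IsCurvature (flatConn φ) R)
    (x ζ η κ : Vec n) : R x ζ η κ = 0 := by
  have h1 : ∀ᵐ y ∂(volume : Measure (Vec n)), R y ζ η κ = 0 := by
    refine ae_eq_zero_of_integral_contDiff_smul_eq_zero (hR.1 ζ η κ).locallyIntegrable
      fun h hh hhc => ?_
    rw [hR.2 h hh hhc, ← (isCurvature_flatConn_zero hφ hφ').2 h hh hhc]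
    simp
  have h2 : (fun y => R y ζ η κ) = fun _ => 0 :=
    Continuous.ae_eq_iff_eq volume (hR.1 ζ η κ) continuous_const |>.1 h1
  exact congrFun h2 x

end Curvature

/-! ### The matrix exponential as the flow of a linear field -/

section LinearFlow

variable {n : ℕ}

open scoped Matrix.Norms.Operator in
theorem hasDerivAt_exp_mulVec (A : Mat n n) (x : Vec n) (t : ℝ) :
    HasDerivAt (fun s : ℝ => NormedSpace.exp (s • A) *ᵥ x)
      (A *ᵥ (NormedSpace.exp (t • A) *ᵥ x)) t := by
  have h := hasDerivAt_exp_smul_const' (𝕂 := ℝ) A t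
  let L : Mat n n →ₗ[ℝ] Vec n := (Matrix.mulVecBilin ℝ ℝ).flip x
  have h2 := (L.toContinuousLinearMap.hasFDerivAt).comp_hasDerivAt t h
  rw [Matrix.mulVec_mulVec]
  exact h2

theorem exp_smul_mul_exp_neg_smul (A : Mat n n) (t : ℝ) :
    NormedSpace.exp (t • A) * NormedSpace.exp (-t • A) = 1 := by
  rw [← Matrix.exp_add_of_commute _ _ (by rw [neg_smul]; exact (Commute.refl _).neg_right)]
  simp

theorem continuous_exp_smul (A : Mat n n) : Continuous fun s : ℝ => NormedSpace.exp (s • A) := by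
  refine continuous_matrix fun i j => ?_
  have h : Continuous fun s : ℝ => (NormedSpace.exp (s • A) *ᵥ basisVec j) :=
    continuous_iff_continuousAt.2 fun t => (hasDerivAt_exp_mulVec A (basisVec j) t).continuousAt
  have := (continuous_apply i).comp h
  simpa [Function.comp_def, basisVec] using this

theorem eq_exp_mulVec_of_hasDerivAt (A : Mat n n) {f : ℝ → Vec n}
    (hf : ∀ t, HasDerivAt f (A *ᵥ f t) t) (t : ℝ) : f t = NormedSpace.exp (t • A) *ᵥ f 0 := by
  have h := ODE_solution_unique_univ (v := fun _ z => A *ᵥ z) (s := fun _ => univ) (t₀ := 0)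
    (f := f) (g := fun t => NormedSpace.exp (t • A) *ᵥ f 0)
    (fun _ => ((Matrix.mulVecLin A).toContinuousLinearMap.lipschitz).lipschitzOnWith)
    (fun t => ⟨hf t, mem_univ _⟩) (fun t => ⟨hasDerivAt_exp_mulVec A _ t, mem_univ _⟩) (by simp)
  exact congrFun h t

end LinearFlow

/-! ### The quantities of the GI filter for the transformed linear model -/

section LinearModel

variable {p q : ℕ} {φ : Vec p ≃ Vec p} {θ : Vec q ≃ Vec q}

theorem jac_conj_mulVec (hφ' : ContDiff ℝ 2 φ.symm) (hθ : ContDiff ℝ 2 θ) (L : Mat q p)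
    (y : Vec p) :
    jac (fun z => θ (L *ᵥ φ.symm z)) y = jac θ (L *ᵥ φ.symm y) * L * jac φ.symm y := by
  have hL : ContDiff ℝ 2 fun z => L *ᵥ φ.symm z := (contDiff_mulVec L).comp hφ'
  have h1 := jac_comp (f := θ) (g := fun z => L *ᵥ φ.symm z) (x := y)
    (hθ.differentiable (by norm_num) _) (hL.differentiable (by norm_num) _)
  have h2 := jac_comp (f := fun z => L *ᵥ z) (g := φ.symm) (x := y)
    ((contDiff_mulVec L (r := 2)).differentiable (by norm_num) _)
    (hφ'.differentiable (by norm_num) _)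
  simp only [Function.comp_def] at h1 h2
  rw [h1, h2, jac_mulVec_fun, Matrix.mul_assoc]

theorem integral_matrix_conj {M : ℝ → Mat p p} (hM : Continuous M) (P : Mat p p) (a b : ℝ) :
    (Matrix.of fun i j => ∫ s in a..b, (P * M s * Pᵀ) i j)
      = P * (Matrix.of fun i j => ∫ s in a..b, M s i j) * Pᵀ := by
  ext i j
  have hc : ∀ k l, Continuous fun s => M s k l := fun k l => hM.matrix_elem k l
  simp only [Matrix.of_apply, Matrix.mul_apply, Matrix.transpose_apply, Finset.sum_mul]
  rw [intervalIntegral.integral_finsetSum fun k _ =>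
    (continuous_finsetSum _ fun l _ => by have := hc l k; fun_prop).intervalIntegrable _ _]
  refine Finset.sum_congr rfl fun k _ => ?_
  rw [intervalIntegral.integral_finsetSum fun l _ =>
    (by have := hc l k; fun_prop : Continuous _).intervalIntegrable _ _]
  refine Finset.sum_congr rfl fun l _ => ?_
  rw [intervalIntegral.integral_mul_const, intervalIntegral.integral_const_mul]

/-- The flow of the linear field `A x`, in the coordinates `φ`. -/
def linearFlow (φ : Vec p ≃ Vec p) (A : Mat p p) (t : ℝ) (y : Vec p) : Vec p :=
  φ (NormedSpace.exp (t • A) *ᵥ φ.symm y)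

/-- Chain rule for `φ ∘ exp(tA) ∘ φ⁻¹`: the Jacobians at the initial point cancel, and only those at
times `s` and `t` remain. -/
theorem tau_linearFlow (hφ : ContDiff ℝ 2 φ) (hφ' : ContDiff ℝ 2 φ.symm) (A : Mat p p)
    (x : Vec p) (s t : ℝ) :
    tau (linearFlow φ A) (φ x) s t = jac φ (NormedSpace.exp (t • A) *ᵥ x)
      * NormedSpace.exp ((t - s) • A) * jac φ.symm (φ (NormedSpace.exp (s • A) *ᵥ x)) := by
  have hj : ∀ r, jac (linearFlow φ A r) (φ x)
      = jac φ (NormedSpace.exp (r • A) *ᵥ x) * NormedSpace.exp (r • A) * jac φ.symm (φ x) :=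
    fun r => by
      have := jac_conj_mulVec hφ' hφ (NormedSpace.exp (r • A)) (φ x)
      rw [φ.symm_apply_apply] at this
      exact this
  have hexp : NormedSpace.exp (t • A) * NormedSpace.exp (-s • A)
      = NormedSpace.exp ((t - s) • A) := by
    rw [sub_eq_add_neg, add_smul, Matrix.exp_add_of_commute]
    exact ((Commute.refl A).smul_left t).smul_right (-s)
  have hinv : (NormedSpace.exp (s • A))⁻¹ = NormedSpace.exp (-s • A) :=
    Matrix.inv_eq_right_inv (exp_smul_mul_exp_neg_smul A s)
  rw [tau, hj, hj, Matrix.mul_inv_rev, Matrix.mul_inv_rev, jac_symm_inv hφ hφ', jac_inv hφ hφ',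
    hinv, ← hexp]
  calc _ = jac φ (NormedSpace.exp (t • A) *ᵥ x) * NormedSpace.exp (t • A)
        * (jac φ.symm (φ x) * jac φ x) * NormedSpace.exp (-s • A)
        * jac φ.symm (φ (NormedSpace.exp (s • A) *ᵥ x)) := by simp only [Matrix.mul_assoc]
    _ = _ := by rw [jac_symm_mul_jac hφ hφ']; simp only [Matrix.mul_assoc, Matrix.one_mul]

variable (A σ g : Mat p p) (J : Mat q p) (B : Mat q q)

theorem α_map_linearModel (y : Vec p) : ((linearModel A σ g J B).map φ θ).α y
    = jac φ (φ.symm y) * (σ * σᵀ) * (jac φ (φ.symm y))ᵀ := by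
  simp only [Model.α, Model.map, linearModel, Matrix.transpose_mul, Matrix.mul_assoc]

theorem jac_symm_inv' (hφ : ContDiff ℝ 2 φ) (hφ' : ContDiff ℝ 2 φ.symm) (y : Vec p) :
    (jac φ (φ.symm y))⁻¹ = jac φ.symm y := by
  rw [jac_inv hφ hφ', φ.apply_symm_apply]

theorem g_map_linearModel (hφ : ContDiff ℝ 2 φ) (hφ' : ContDiff ℝ 2 φ.symm) :
    ((linearModel A σ g J B).map φ θ).g = pullForm φ g := by
  funext y
  simp only [Model.map, linearModel, jac_symm_inv' hφ hφ', pullForm]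

theorem isSymm_mul_transpose : (σ * σᵀ)ᵀ = σ * σᵀ := by simp

variable {g B}

theorem stateConn_map_linearModel (hφ : ContDiff ℝ 2 φ) (hφ' : ContDiff ℝ 2 φ.symm)
    (hg : g.PosDef) : ((linearModel A σ g J B).map φ θ).stateConn = flatConn φ := by
  have h := subRiemannian_pullForm hφ hφ' (isSymm_mul_transpose σ)
    (by simpa using hg.isHermitian.eq : gᵀ = g) hg.isUnit
  rw [← h, Model.stateConn, g_map_linearModel A σ g J B hφ hφ']
  congr 1
  funext y
  exact α_map_linearModel A σ g J B y

theorem obsConn_map_linearModel (hθ : ContDiff ℝ 2 θ) (hθ' : ContDiff ℝ 2 θ.symm)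
    (hB : B.PosDef) : ((linearModel A σ g J B).map φ θ).obsConn = flatConn θ := by
  have h := leviCivita_pullForm hθ hθ' (G := B⁻¹)
    (by simpa using hB.inv.isHermitian.eq) hB.inv.isUnit
  rw [← h, Model.obsConn]
  congr 1
  funext y
  simp only [Model.map, linearModel, pullForm, Matrix.mul_inv_rev, jac_symm_inv' hθ hθ',
    ← Matrix.transpose_nonsing_inv, Matrix.mul_assoc]

/-- By `flatConn_fderiv`, the term `½ αⁱʲ Γᵢⱼ` is minus the Itô correction in the transformed drift.
So `ξ` is the plain push-forward of `A x`, whatever `σ` is. -/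
theorem ξ_map_linearModel (hφ : ContDiff ℝ 2 φ) (hφ' : ContDiff ℝ 2 φ.symm) (hg : g.PosDef)
    (y : Vec p) :
    ((linearModel A σ g J B).map φ θ).ξ y = jac φ (φ.symm y) *ᵥ (A *ᵥ φ.symm y) := by
  have h1 : contract (flatConn φ y) (jac φ (φ.symm y) * (σ * σᵀ) * (jac φ (φ.symm y))ᵀ)
      = - contract (hess φ (φ.symm y)) (σ * σᵀ) := by
    -- Presents `flatConn φ y` as a continuous bilinear map, the form in which the transformation
    -- law applies.
    have h2 := contract_conj ((ContinuousLinearMap.compL ℝ _ _ _ (fderiv ℝ φ (φ.symm y))).comp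
      (fderiv ℝ (fderiv ℝ φ.symm) y)) (jac φ (φ.symm y)) (σ * σᵀ)
    have h3 : ∀ u v, ((ContinuousLinearMap.compL ℝ _ _ _ (fderiv ℝ φ (φ.symm y))).comp
      (fderiv ℝ (fderiv ℝ φ.symm) y)) u v = flatConn φ y u v := fun u v => rfl
    simp only [h3, jac_mulVec] at h2
    have h4 : ∀ u v, flatConn φ y (fderiv ℝ φ (φ.symm y) u) (fderiv ℝ φ (φ.symm y) v)
        = (-ContinuousLinearMap.id ℝ (Vec p)) (hess φ (φ.symm y) u v) := fun u v => by
      have := flatConn_fderiv hφ hφ' (φ.symm y) u v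
      rw [φ.apply_symm_apply] at this
      simpa using this
    rw [contract_congr h4, contract_clm] at h2
    rw [← h2]
    simp
  rw [Model.ξ, stateConn_map_linearModel A σ J hφ hφ' hg, α_map_linearModel, h1]
  simp only [Model.map]
  have h5 : (linearModel A σ g J B).α (φ.symm y) = σ * σᵀ := rfl
  have h6 : (linearModel A σ g J B).b (φ.symm y) = A *ᵥ φ.symm y := rfl
  rw [h5, h6, smul_neg, add_neg_cancel_right]

/-- Read through `φ⁻¹`, the equation is linear, so global Lipschitz uniqueness applies. -/
theorem isFlow_map_linearModel_iff (hφ : ContDiff ℝ 2 φ) (hφ' : ContDiff ℝ 2 φ.symm)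
    (hg : g.PosDef) (Φ : ℝ → Vec p → Vec p) :
    ((linearModel A σ g J B).map φ θ).IsFlow Φ ↔ Φ = linearFlow φ A := by
  simp only [Model.IsFlow, ξ_map_linearModel A σ J hφ hφ' hg, jac_mulVec]
  constructor
  · intro h
    funext t y
    have h1 : ∀ s, HasDerivAt (fun s => φ.symm (Φ s y)) (A *ᵥ φ.symm (Φ s y)) s := fun s => by
      have := ((hφ'.differentiable (by norm_num)) (Φ s y)).hasFDerivAt.comp_hasDerivAt s
        ((h y).2 s)
      rw [fderiv_symm_fderiv_symm hφ hφ'] at this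
      exact this
    have h2 := eq_exp_mulVec_of_hasDerivAt A h1 t
    rw [(h y).1] at h2
    rw [linearFlow, ← h2, φ.apply_symm_apply]
  · rintro rfl y
    refine ⟨by simp [linearFlow], fun t => ?_⟩
    have := ((hφ.differentiable (by norm_num)) _).hasFDerivAt.comp_hasDerivAt t
      (hasDerivAt_exp_mulVec A (φ.symm y) t)
    simp only [linearFlow, φ.symm_apply_apply]
    exact this

variable (g B)

theorem flowForm_linearFlow (hφ : ContDiff ℝ 2 φ) (hφ' : ContDiff ℝ 2 φ.symm) (hg : g.PosDef)
    (y : Vec p) (t : ℝ) :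
    ((linearModel A σ g J B).map φ θ).flowForm (linearFlow φ A) y t = fun _ _ => 0 := by
  funext u v
  rw [Model.flowForm, stateConn_map_linearModel A σ J hφ hφ' hg]
  exact secondFundForm_flatConn hφ hφ' hφ hφ' _ y u v

theorem obsForm_map_linearModel (hφ : ContDiff ℝ 2 φ) (hφ' : ContDiff ℝ 2 φ.symm)
    (hθ : ContDiff ℝ 2 θ) (hθ' : ContDiff ℝ 2 θ.symm) (hg : g.PosDef) (hB : B.PosDef)
    (y : Vec p) :
    ((linearModel A σ g J B).map φ θ).obsForm y = fun _ _ => 0 := by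
  funext u v
  rw [Model.obsForm, stateConn_map_linearModel A σ J hφ hφ' hg,
    obsConn_map_linearModel A σ J hθ hθ' hB]
  exact secondFundForm_flatConn hφ hφ' hθ hθ' J y u v

/-- The covariance matrix of `X_δ` for `dX = A X dt + σ dW`, when `X_0` has covariance `C`. -/
def priorCov (A σ : Mat p p) (C : Mat p p) (δ : ℝ) : Mat p p :=
  NormedSpace.exp (δ • A) * C * (NormedSpace.exp (δ • A))ᵀ
    + Matrix.of fun i j => ∫ u in (0 : ℝ)..δ,
        (NormedSpace.exp (u • A) * (σ * σᵀ) * (NormedSpace.exp (u • A))ᵀ) i j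

/-- The Kalman gain. -/
def kalmanGain (A σ : Mat p p) (J : Mat q p) (B : Mat q q) (C : Mat p p) (δ : ℝ) : Mat p q :=
  priorCov A σ C δ * Jᵀ * (J * priorCov A σ C δ * Jᵀ + B)⁻¹

theorem kalmanStep_eq (δ : ℝ) (y : Vec q) (s : Vec p × Mat p p) :
    kalmanStep A σ J B δ y s
      = (NormedSpace.exp (δ • A) *ᵥ s.1
          + kalmanGain A σ J B s.2 δ *ᵥ (y - J *ᵥ (NormedSpace.exp (δ • A) *ᵥ s.1)),
        (1 - kalmanGain A σ J B s.2 δ * J) * priorCov A σ s.2 δ) := rfl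

/-- The Jacobians at the moving point `x_s` cancel between `tau` and `α`. Only the fixed Jacobian at
the starting point survives, so it can be taken out of the time integral. -/
theorem dPi_linearFlow (hφ : ContDiff ℝ 2 φ) (hφ' : ContDiff ℝ 2 φ.symm) (x : Vec p) (s : ℝ) :
    ((linearModel A σ g J B).map φ θ).dPi (linearFlow φ A) (φ x) s
      = jac φ x * (NormedSpace.exp (-s • A) * (σ * σᵀ) * (NormedSpace.exp (-s • A))ᵀ)
        * (jac φ x)ᵀ := by
  have h0 := jac_symm_mul_jac hφ hφ' (NormedSpace.exp (s • A) *ᵥ x)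
  have h1 : ((jac φ (NormedSpace.exp (s • A) *ᵥ x)))ᵀ
      * (jac φ.symm (φ (NormedSpace.exp (s • A) *ᵥ x)))ᵀ = 1 := by
    rw [← Matrix.transpose_mul, h0, Matrix.transpose_one]
  rw [Model.dPi, α_map_linearModel, tau_linearFlow hφ hφ', linearFlow, φ.symm_apply_apply,
    φ.symm_apply_apply, zero_smul, NormedSpace.exp_zero, Matrix.one_mulVec, zero_sub]
  simp only [Matrix.transpose_mul]
  calc _ = jac φ x * NormedSpace.exp (-s • A)
        * (jac φ.symm (φ (NormedSpace.exp (s • A) *ᵥ x)) * jac φ (NormedSpace.exp (s • A) *ᵥ x))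
        * (σ * σᵀ) * ((jac φ (NormedSpace.exp (s • A) *ᵥ x))ᵀ
          * (jac φ.symm (φ (NormedSpace.exp (s • A) *ᵥ x)))ᵀ)
        * (NormedSpace.exp (-s • A))ᵀ * (jac φ x)ᵀ := by simp only [Matrix.mul_assoc]
    _ = _ := by rw [h0, h1]; simp only [Matrix.mul_assoc, Matrix.one_mul]

theorem Xi_linearFlow (hφ : ContDiff ℝ 2 φ) (hφ' : ContDiff ℝ 2 φ.symm) (x : Vec p) (C : Mat p p)
    (δ : ℝ) :
    ((linearModel A σ g J B).map φ θ).Xi (linearFlow φ A) (φ x) (jac φ x * C * (jac φ x)ᵀ) δ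
      = jac φ (NormedSpace.exp (δ • A) *ᵥ x) * priorCov A σ C δ
        * (jac φ (NormedSpace.exp (δ • A) *ᵥ x))ᵀ := by
  have hexp : ∀ s, NormedSpace.exp (δ • A) * NormedSpace.exp (-s • A)
      = NormedSpace.exp ((δ - s) • A) := fun s => by
    rw [sub_eq_add_neg, add_smul, Matrix.exp_add_of_commute]
    exact ((Commute.refl A).smul_left δ).smul_right (-s)
  have hcont : ∀ f : ℝ → ℝ, Continuous f → Continuous fun s : ℝ =>
      NormedSpace.exp (f s • A) * (σ * σᵀ) * (NormedSpace.exp (f s • A))ᵀ := fun f hf => by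
    have := (continuous_exp_smul A).comp hf
    exact (this.matrix_mul continuous_const).matrix_mul this.matrix_transpose
  have h0 := jac_symm_mul_jac hφ hφ' x
  have h1 : (jac φ x)ᵀ * (jac φ.symm (φ x))ᵀ = 1 := by
    rw [← Matrix.transpose_mul, h0, Matrix.transpose_one]
  have h2 : (NormedSpace.exp (δ • A) * (Matrix.of fun i j => ∫ s in (0 : ℝ)..δ,
        (NormedSpace.exp (-s • A) * (σ * σᵀ) * (NormedSpace.exp (-s • A))ᵀ) i j)
        * (NormedSpace.exp (δ • A))ᵀ)
      = Matrix.of fun i j => ∫ u in (0 : ℝ)..δ,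
        (NormedSpace.exp (u • A) * (σ * σᵀ) * (NormedSpace.exp (u • A))ᵀ) i j := by
    rw [← integral_matrix_conj (hcont _ continuous_neg)]
    ext i j
    simp only [Matrix.of_apply]
    -- The substitution `u = δ - s` turns noise transported back to time `0` and then forward to `δ`
    -- into the Kalman covariance integral.
    have h3 := intervalIntegral.integral_comp_sub_left (a := 0) (b := δ) (fun u =>
      (NormedSpace.exp (u • A) * (σ * σᵀ) * (NormedSpace.exp (u • A))ᵀ) i j) δ
    rw [sub_self, sub_zero] at h3
    rw [← h3]
    congr 1
    funext s
    rw [← hexp, Matrix.transpose_mul]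
    simp only [Matrix.mul_assoc]
  rw [Model.Xi, Model.PiTensor]
  simp only [dPi_linearFlow A σ g J B hφ hφ']
  rw [integral_matrix_conj (hcont _ continuous_neg), tau_linearFlow hφ hφ', priorCov, ← h2,
    zero_smul, NormedSpace.exp_zero, Matrix.one_mulVec, sub_zero, ← Matrix.add_mul,
    ← Matrix.mul_add]
  set D := jac φ (NormedSpace.exp (δ • A) *ᵥ x)
  set I := Matrix.of fun i j => ∫ s in (0 : ℝ)..δ,
        (NormedSpace.exp (-s • A) * (σ * σᵀ) * (NormedSpace.exp (-s • A))ᵀ) i j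
  simp only [Matrix.transpose_mul]
  calc _ = D * NormedSpace.exp (δ • A) * (jac φ.symm (φ x) * jac φ x) * (C + I)
        * ((jac φ x)ᵀ * (jac φ.symm (φ x))ᵀ) * (NormedSpace.exp (δ • A))ᵀ * Dᵀ := by
        simp only [Matrix.mul_assoc]
    _ = _ := by
        rw [h0, h1]
        simp only [Matrix.mul_one, Matrix.mul_add, Matrix.add_mul, Matrix.mul_assoc]

theorem jac_ψ_map_linearModel (hφ' : ContDiff ℝ 2 φ.symm) (hθ : ContDiff ℝ 2 θ) (x : Vec p) :
    jac ((linearModel A σ g J B).map φ θ).ψ (φ x) = jac θ (J *ᵥ x) * J * jac φ.symm (φ x) := by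
  have := jac_conj_mulVec hφ' hθ J (φ x)
  rw [φ.symm_apply_apply] at this
  exact this

/-- The innovation covariance is conjugated by `T = Dθ`. As the inverse of a product reverses
without conditions, only the Jacobians have to be invertible, and `C` can be arbitrary. -/
theorem gain_linearFlow (hφ : ContDiff ℝ 2 φ) (hφ' : ContDiff ℝ 2 φ.symm) (hθ : ContDiff ℝ 2 θ)
    (hθ' : ContDiff ℝ 2 θ.symm) (x : Vec p) (C : Mat p p) (δ : ℝ) :
    ((linearModel A σ g J B).map φ θ).gain (linearFlow φ A) (φ x) (jac φ x * C * (jac φ x)ᵀ) δ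
      = jac φ (NormedSpace.exp (δ • A) *ᵥ x) * kalmanGain A σ J B C δ
        * jac θ.symm (θ (J *ᵥ (NormedSpace.exp (δ • A) *ᵥ x))) := by
  have hx : linearFlow φ A δ (φ x) = φ (NormedSpace.exp (δ • A) *ᵥ x) := by
    rw [linearFlow, φ.symm_apply_apply]
  rw [Model.gain, Xi_linearFlow A σ g J B hφ hφ', hx, jac_ψ_map_linearModel A σ g J B hφ' hθ]
  have hβ : ((linearModel A σ g J B).map φ θ).β (((linearModel A σ g J B).map φ θ).ψ
      (φ (NormedSpace.exp (δ • A) *ᵥ x))) = jac θ (J *ᵥ (NormedSpace.exp (δ • A) *ᵥ x)) * B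
        * (jac θ (J *ᵥ (NormedSpace.exp (δ • A) *ᵥ x)))ᵀ := by
    simp only [Model.map, linearModel, Equiv.symm_apply_apply]
  rw [hβ]
  set m := NormedSpace.exp (δ • A) *ᵥ x
  set T := jac θ (J *ᵥ m) with hT
  have h0 := jac_symm_mul_jac hφ hφ' m
  have h1 : (jac φ m)ᵀ * (jac φ.symm (φ m))ᵀ = 1 := by
    rw [← Matrix.transpose_mul, h0, Matrix.transpose_one]
  have hTT : Tᵀ * (Tᵀ)⁻¹ = 1 := by
    rw [← Matrix.transpose_nonsing_inv, ← Matrix.transpose_mul, hT, jac_inv hθ hθ',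
      jac_symm_mul_jac hθ hθ', Matrix.transpose_one]
  have h2 : T * J * jac φ.symm (φ m) * (jac φ m * priorCov A σ C δ * (jac φ m)ᵀ)
      * (T * J * jac φ.symm (φ m))ᵀ + T * B * Tᵀ
      = T * (J * priorCov A σ C δ * Jᵀ + B) * Tᵀ := by
    simp only [Matrix.transpose_mul, Matrix.mul_add, Matrix.add_mul]
    congr 1
    calc _ = T * J * (jac φ.symm (φ m) * jac φ m) * priorCov A σ C δ
          * ((jac φ m)ᵀ * (jac φ.symm (φ m))ᵀ) * Jᵀ * Tᵀ := by simp only [Matrix.mul_assoc]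
      _ = _ := by rw [h0, h1]; simp only [Matrix.mul_assoc, Matrix.one_mul]
  rw [h2, Matrix.mul_inv_rev, Matrix.mul_inv_rev, ← jac_inv hθ hθ', kalmanGain]
  simp only [Matrix.transpose_mul]
  calc _ = jac φ m * priorCov A σ C δ * ((jac φ m)ᵀ * (jac φ.symm (φ m))ᵀ) * Jᵀ
        * (Tᵀ * (Tᵀ)⁻¹) * ((J * priorCov A σ C δ * Jᵀ + B)⁻¹ * T⁻¹) := by
        simp only [Matrix.mul_assoc]
    _ = _ := by rw [h1, hTT, ← hT]; simp only [Matrix.mul_assoc, Matrix.one_mul]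

theorem condVar_linearFlow (hφ : ContDiff ℝ 2 φ) (hφ' : ContDiff ℝ 2 φ.symm)
    (hθ : ContDiff ℝ 2 θ) (hθ' : ContDiff ℝ 2 θ.symm) (x : Vec p) (C : Mat p p) (δ : ℝ) :
    ((linearModel A σ g J B).map φ θ).condVar (linearFlow φ A) (φ x) (jac φ x * C * (jac φ x)ᵀ) δ
      = jac φ (NormedSpace.exp (δ • A) *ᵥ x)
        * ((1 - kalmanGain A σ J B C δ * J) * priorCov A σ C δ)
        * (jac φ (NormedSpace.exp (δ • A) *ᵥ x))ᵀ := by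
  have hx : linearFlow φ A δ (φ x) = φ (NormedSpace.exp (δ • A) *ᵥ x) := by
    rw [linearFlow, φ.symm_apply_apply]
  rw [Model.condVar, gain_linearFlow A σ g J B hφ hφ' hθ hθ', Xi_linearFlow A σ g J B hφ hφ', hx,
    jac_ψ_map_linearModel A σ g J B hφ' hθ]
  set m := NormedSpace.exp (δ • A) *ᵥ x
  have h0 := jac_symm_mul_jac hφ hφ' m
  have h1 := jac_symm_mul_jac hθ hθ' (J *ᵥ m)
  rw [Matrix.sub_mul, Matrix.sub_mul, Matrix.mul_sub, Matrix.sub_mul, Matrix.one_mul,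
    Matrix.one_mul]
  congr 1
  calc _ = jac φ m * kalmanGain A σ J B C δ * (jac θ.symm (θ (J *ᵥ m)) * jac θ (J *ᵥ m)) * J
        * (jac φ.symm (φ m) * jac φ m) * priorCov A σ C δ * (jac φ m)ᵀ := by
        simp only [Matrix.mul_assoc]
    _ = _ := by rw [h0, h1]; simp only [Matrix.mul_assoc, Matrix.one_mul]

/-- Every correction to `G Z` is built from a second fundamental form, and all of these vanish. -/
theorem condMean_linearFlow (hφ : ContDiff ℝ 2 φ) (hφ' : ContDiff ℝ 2 φ.symm)
    (hθ : ContDiff ℝ 2 θ) (hθ' : ContDiff ℝ 2 θ.symm) (hg : g.PosDef) (hB : B.PosDef)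
    (y : Vec p) (C : Mat p p) (δ : ℝ) (Z : Vec q) :
    ((linearModel A σ g J B).map φ θ).condMean (linearFlow φ A) y C δ Z
      = ((linearModel A σ g J B).map φ θ).gain (linearFlow φ A) y C δ *ᵥ Z := by
  have hrho : ((linearModel A σ g J B).map φ θ).rho (linearFlow φ A) y C δ = fun _ _ => 0 := by
    funext u v
    simp only [Model.rho, flowForm_linearFlow A σ g J B hφ hφ' hg,
      obsForm_map_linearModel A σ g J B hφ hφ' hθ hθ' hg hB, Matrix.mulVec_zero, sub_zero,
      smul_zero]
  simp only [Model.condMean, hrho, Model.stateAILP, Model.obsAILP,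
    flowForm_linearFlow A σ g J B hφ hφ' hg,
    obsForm_map_linearModel A σ g J B hφ hφ' hθ hθ' hg hB, contract_zero, Matrix.mulVec_zero,
    intervalIntegral.integral_zero, sub_zero, add_zero, smul_zero, zero_add]

/-- One direction shows that no choice of flow, curvature, logarithm or local exponential affects
the result; the other exhibits such choices, so that the step is well defined. -/
theorem giStep_map_linearModel_iff (hφ : ContDiff ℝ 2 φ) (hφ' : ContDiff ℝ 2 φ.symm)
    (hθ : ContDiff ℝ 2 θ) (hθ' : ContDiff ℝ 2 θ.symm) (hg : g.PosDef) (hB : B.PosDef)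
    (δ : ℝ) (x : Vec p) (C : Mat p p) (y : Vec q) (x₁ : Vec p) (C₁ : Mat p p) :
    ((linearModel A σ g J B).map φ θ).GIStep δ (φ x) (jac φ x * C * (jac φ x)ᵀ) (θ y) x₁ C₁ ↔
      x₁ = φ (kalmanStep A σ J B δ y (x, C)).1 ∧
        C₁ = jac φ (kalmanStep A σ J B δ y (x, C)).1 * (kalmanStep A σ J B δ y (x, C)).2
          * (jac φ (kalmanStep A σ J B δ y (x, C)).1)ᵀ := by
  have hx : linearFlow φ A δ (φ x) = φ (NormedSpace.exp (δ • A) *ᵥ x) := by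
    rw [linearFlow, φ.symm_apply_apply]
  have hψ : ((linearModel A σ g J B).map φ θ).ψ (φ (NormedSpace.exp (δ • A) *ᵥ x))
      = θ (J *ᵥ (NormedSpace.exp (δ • A) *ᵥ x)) := by
    simp only [Model.map, linearModel, Equiv.symm_apply_apply]
  simp only [Model.GIStep, isFlow_map_linearModel_iff A σ J hφ hφ' hg,
    stateConn_map_linearModel A σ J hφ hφ' hg, obsConn_map_linearModel A σ J hθ hθ' hB,
    kalmanStep_eq, isExp_flatConn hφ hφ', isExp_flatConn hθ hθ']
  set m := NormedSpace.exp (δ • A) *ᵥ x with hm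
  clear_value m
  have hexp : ∀ w, DifferentiableAt ℝ (fun w => φ (m + fderiv ℝ φ.symm (φ m) w)) w ∧
      jac (fun w => φ (m + fderiv ℝ φ.symm (φ m) w)) w
        = jac φ (m + fderiv ℝ φ.symm (φ m) w) * jac φ.symm (φ m) := fun w => by
    have h1 : HasFDerivAt (fun w => m + fderiv ℝ φ.symm (φ m) w) (fderiv ℝ φ.symm (φ m)) w :=
      (fderiv ℝ φ.symm (φ m)).hasFDerivAt.const_add m
    have h2 := ((hφ.differentiable (by norm_num)) (m + fderiv ℝ φ.symm (φ m) w)).hasFDerivAt.comp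
      w h1
    refine ⟨h2.differentiableAt, jac_eq_of_mulVec fun u => ?_⟩
    have h3 := h2.fderiv
    simp only [Function.comp_def] at h3
    rw [h3, ← Matrix.mulVec_mulVec, jac_mulVec, jac_mulVec]
    rfl
  -- Injectivity of `θ` forces `Dθ⁻¹ Z` to be the Kalman innovation `y - J m`. The gain acting on
  -- `Z`, read in flat coordinates, is then the Kalman correction.
  have hv : ∀ Z, θ y = θ (J *ᵥ m + fderiv ℝ θ.symm (θ (J *ᵥ m)) Z) →
      fderiv ℝ φ.symm (φ m) ((jac φ m * kalmanGain A σ J B C δ * jac θ.symm (θ (J *ᵥ m))) *ᵥ Z)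
        = kalmanGain A σ J B C δ *ᵥ (y - J *ᵥ m) := fun Z hZ => by
    have h1 : y - J *ᵥ m = jac θ.symm (θ (J *ᵥ m)) *ᵥ Z := by
      rw [θ.injective hZ, jac_mulVec, add_sub_cancel_left]
    rw [h1, ← jac_mulVec, Matrix.mulVec_mulVec, Matrix.mulVec_mulVec, ← Matrix.mul_assoc,
      ← Matrix.mul_assoc, jac_symm_mul_jac hφ hφ', Matrix.one_mul]
  -- The derivative of the exponential map only replaces the Jacobian at the predicted mean `m` by
  -- the one at the updated mean `a`.
  have hcov : ∀ a, jac φ a * jac φ.symm (φ m) * (jac φ m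
      * ((1 - kalmanGain A σ J B C δ * J) * priorCov A σ C δ) * (jac φ m)ᵀ)
      * (jac φ a * jac φ.symm (φ m))ᵀ
      = jac φ a * ((1 - kalmanGain A σ J B C δ * J) * priorCov A σ C δ) * (jac φ a)ᵀ := fun a => by
    have h0 := jac_symm_mul_jac hφ hφ' m
    have h1 : (jac φ m)ᵀ * (jac φ.symm (φ m))ᵀ = 1 := by
      rw [← Matrix.transpose_mul, h0, Matrix.transpose_one]
    rw [Matrix.transpose_mul]
    calc _ = jac φ a * (jac φ.symm (φ m) * jac φ m)
          * ((1 - kalmanGain A σ J B C δ * J) * priorCov A σ C δ)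
          * ((jac φ m)ᵀ * (jac φ.symm (φ m))ᵀ) * (jac φ a)ᵀ := by simp only [Matrix.mul_assoc]
      _ = _ := by rw [h0, h1]; simp only [Matrix.mul_assoc, Matrix.one_mul]
  constructor
  · rintro ⟨Φ, R, Z, e, v, rfl, hR, hZ, hv', he, -, rfl, rfl⟩
    rw [hx, hψ, θ.symm_apply_apply] at hZ
    simp only [condMean_linearFlow A σ g J B hφ hφ' hθ hθ' hg hB, hR.eq_zero_of_flatConn hφ hφ',
      smul_zero, Finset.sum_const_zero, sub_zero, gain_linearFlow A σ g J B hφ hφ' hθ hθ'] at hv'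
    rw [hx, φ.symm_apply_apply] at he
    -- Only the germ of `e` at `v` is determined, which suffices for its value and its Jacobian.
    have he' : e =ᶠ[𝓝 v] fun w => φ (m + fderiv ℝ φ.symm (φ m) w) := he
    have hjac : jac e v = jac φ (m + fderiv ℝ φ.symm (φ m) v) * jac φ.symm (φ m) := by
      rw [← (hexp v).2]
      unfold jac
      rw [he'.fderiv_eq]
    have hv2 := hv Z hZ
    rw [← hm] at hv'
    rw [← hv'] at hv2
    rw [hjac, he'.eq_of_nhds, condVar_linearFlow A σ g J B hφ hφ' hθ hθ', ← hm, hcov]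
    simp only [hv2, and_self]
  · rintro ⟨rfl, rfl⟩
    -- The logarithm of the observation is `Dθ` applied to the Kalman innovation.
    have hZ : θ y = θ (J *ᵥ m + fderiv ℝ θ.symm (θ (J *ᵥ m)) (fderiv ℝ θ (J *ᵥ m) (y - J *ᵥ m))) := by
      rw [fderiv_symm_fderiv hθ hθ', add_sub_cancel]
    have hv2 := hv _ hZ
    refine ⟨linearFlow φ A, fun _ _ _ _ => 0, fderiv ℝ θ (J *ᵥ m) (y - J *ᵥ m),
      fun w => φ (m + fderiv ℝ φ.symm (φ m) w),
      (jac φ m * kalmanGain A σ J B C δ * jac θ.symm (θ (J *ᵥ m)))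
        *ᵥ fderiv ℝ θ (J *ᵥ m) (y - J *ᵥ m), rfl, isCurvature_flatConn_zero hφ hφ', ?_, ?_,
      ?_, (hexp _).1, ?_, ?_⟩
    · rw [hx, hψ, θ.symm_apply_apply]
      exact hZ
    · simp only [condMean_linearFlow A σ g J B hφ hφ' hθ hθ' hg hB, smul_zero,
        Finset.sum_const_zero, sub_zero, gain_linearFlow A σ g J B hφ hφ' hθ hθ', ← hm]
    · rw [hx, φ.symm_apply_apply]
      exact .of_forall fun w => rfl
    · simp only [hv2]
    · rw [(hexp _).2, condVar_linearFlow A σ g J B hφ hφ' hθ hθ', ← hm, hcov, hv2]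

end LinearModel

/-! ### Measurable dependence of the transformed coefficients on past observations -/

section Measurability

variable {Ω : Type*} {mΩ : MeasurableSpace Ω} {a b c : ℕ} {M : Ω → Mat a b}

theorem measurable_mulVec (hM : ∀ i j, Measurable fun ω => M ω i j) (x : Vec b) :
    Measurable fun ω => M ω *ᵥ x := by
  refine measurable_pi_iff.2 fun i => ?_
  simp only [Matrix.mulVec, dotProduct]
  exact Finset.measurable_fun_sum _ fun j _ => (hM i j).mul_const _

theorem measurable_mul_apply (hM : ∀ i j, Measurable fun ω => M ω i j) {N : Ω → Mat b c}
    (hN : ∀ i j, Measurable fun ω => N ω i j) (i : Fin a) (j : Fin c) :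
    Measurable fun ω => (M ω * N ω) i j := by
  simp only [Matrix.mul_apply]
  exact Finset.measurable_fun_sum _ fun k _ => (hM i k).mul (hN k j)

theorem measurable_contract {M : Ω → Mat a a} (hM : ∀ i j, Measurable fun ω => M ω i j)
    (T : Vec a → Vec a → Vec b) : Measurable fun ω => contract T (M ω) := by
  simp only [contract]
  exact Finset.measurable_fun_sum _ fun i _ => Finset.measurable_fun_sum _ fun j _ =>
    (hM i j).smul_const _

theorem measurable_linearMap_add {f : Ω → Vec a} {g : Ω → Vec b} (L : Mat b a) (r : ℝ)
    (hf : Measurable f) (hg : Measurable g) : Measurable fun ω => L *ᵥ f ω + r • g ω :=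
  ((contDiff_mulVec L (r := 0)).continuous.measurable.comp hf).add (hg.const_smul r)

theorem measurable_comp_snd {f : Ω × Vec a → ENNReal} (hf : Measurable f)
    {ψ : Vec a → Vec a} (hψ : Continuous ψ) : Measurable fun z : Ω × Vec a => f (z.1, ψ z.2) :=
  hf.comp (measurable_fst.prodMk (hψ.measurable.comp measurable_snd))

end Measurability

/-! ### Admissibility of the transformed model -/

section Admissible

variable {p q : ℕ} {φ : Vec p ≃ Vec p} {θ : Vec q ≃ Vec q}

theorem isAdmissible_map_linearModel (A : Mat p p) {σ g : Mat p p} (J : Mat q p) {B : Mat q q}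
    (hφ : ContDiff ℝ 2 φ) (hφ' : ContDiff ℝ 2 φ.symm) (hθ : ContDiff ℝ 2 θ)
    (hθ' : ContDiff ℝ 2 θ.symm) (hg : g.PosDef) (hB : B.PosDef)
    (hgσ : σ * σᵀ * g * (σ * σᵀ) = σ * σᵀ) :
    ((linearModel A σ g J B).map φ θ).IsAdmissible where
  b_cont := by
    simp only [Model.map, jac_mulVec]
    have h1 : Continuous fun x => fderiv ℝ φ (φ.symm x) ((linearModel A σ g J B).b (φ.symm x)) :=
      ((hφ.continuous_fderiv (by norm_num)).comp hφ'.continuous).clm_apply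
        ((contDiff_mulVec A (r := 0)).continuous.comp hφ'.continuous)
    have h2 : Continuous fun x =>
        contract (hess φ (φ.symm x)) ((linearModel A σ g J B).α (φ.symm x)) :=
      continuous_finsetSum _ fun i _ => continuous_finsetSum _ fun j _ =>
        ((continuous_hess hφ _ _).comp hφ'.continuous).const_smul ((σ * σᵀ) i j)
    exact h1.add (h2.const_smul (1 / 2 : ℝ))
  σ_smooth i j := by
    simp only [Model.map, linearModel, Matrix.mul_apply]
    exact ContDiff.sum fun k _ => ((contDiff_jac_apply hφ i k).comp
      (hφ'.of_le (by norm_num))).mul contDiff_const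
  g_smooth i j := by
    rw [g_map_linearModel A σ g J B hφ hφ']
    simp only [pullForm, Matrix.mul_apply, Matrix.transpose_apply]
    exact ContDiff.sum fun k _ => (ContDiff.sum fun l _ =>
      (contDiff_jac_apply hφ' l i).mul contDiff_const).mul (contDiff_jac_apply hφ' k j)
  ψ_smooth := hθ.comp ((contDiff_mulVec J).comp hφ')
  β_smooth i j := by
    simp only [Model.map, linearModel, Matrix.mul_apply, Matrix.transpose_apply]
    have h : ∀ i k, ContDiff ℝ 1 fun y => jac θ (θ.symm y) i k := fun i k =>
      (contDiff_jac_apply hθ i k).comp (hθ'.of_le (by norm_num))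
    exact ContDiff.sum fun k _ => (ContDiff.sum fun l _ =>
      (h i l).mul contDiff_const).mul (h j k)
  const_rank := ⟨σ.rank, fun x => Matrix.rank_mul_eq_right_of_isUnit_det _ _
    ((Matrix.isUnit_iff_isUnit_det _).1 (isUnit_jac hφ hφ' _))⟩
  g_posDef x := by
    rw [g_map_linearModel A σ g J B hφ hφ', pullForm, ← Matrix.conjTranspose_eq_transpose_of_trivial]
    exact (Matrix.IsUnit.posDef_star_left_conjugate_iff (isUnit_jac (φ := φ.symm) hφ' hφ x)).2 hg
  g_inverse x := by
    have h0 : jac φ.symm x * jac φ (φ.symm x) = 1 := by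
      have := jac_symm_mul_jac hφ hφ' (φ.symm x)
      rwa [φ.apply_symm_apply] at this
    have h1 : (jac φ (φ.symm x))ᵀ * (jac φ.symm x)ᵀ = 1 := by
      rw [← Matrix.transpose_mul, h0, Matrix.transpose_one]
    rw [g_map_linearModel A σ g J B hφ hφ', α_map_linearModel, pullForm]
    calc _ = jac φ (φ.symm x) * (σ * σᵀ) * ((jac φ (φ.symm x))ᵀ * (jac φ.symm x)ᵀ) * g
          * (jac φ.symm x * jac φ (φ.symm x)) * (σ * σᵀ) * (jac φ (φ.symm x))ᵀ := by
          simp only [Matrix.mul_assoc]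
      _ = jac φ (φ.symm x) * (σ * σᵀ * g * (σ * σᵀ)) * (jac φ (φ.symm x))ᵀ := by
          rw [h0, h1]; simp only [Matrix.mul_assoc, Matrix.one_mul]
      _ = _ := by rw [hgσ]
  β_posDef y := by
    simp only [Model.map, linearModel]
    rw [← Matrix.conjTranspose_eq_transpose_of_trivial]
    exact (Matrix.IsUnit.posDef_star_right_conjugate_iff (isUnit_jac hθ hθ' _)).2 hB

end Admissible

/-! ### Transport of sigma-fields, laws and the martingale problem -/

section Probability

variable {n : ℕ} {φ : Vec n ≃ Vec n}

theorem measurableEmbedding_of_contDiff (hφ : ContDiff ℝ 2 φ) (hφ' : ContDiff ℝ 2 φ.symm) :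
    MeasurableEmbedding φ :=
  (Homeomorph.mk φ hφ.continuous hφ'.continuous).measurableEmbedding

/-- A diffeomorphism is a measurable embedding, so it loses no information. Histories and
adaptedness are therefore the same for the original and the transformed processes. -/
theorem comap_comp_diffeo {Ω : Type*} (hφ : ContDiff ℝ 2 φ) (hφ' : ContDiff ℝ 2 φ.symm)
    (f : Ω → Vec n) :
    MeasurableSpace.comap (fun ω => φ (f ω)) inferInstance
      = MeasurableSpace.comap f inferInstance := by
  have h := (measurableEmbedding_of_contDiff hφ hφ').comap_eq
  conv_rhs => rw [← h, MeasurableSpace.comap_comp]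
  rfl

theorem obsSigma_comp_diffeo {Ω : Type*} [MeasurableSpace Ω] (hφ : ContDiff ℝ 2 φ)
    (hφ' : ContDiff ℝ 2 φ.symm) (Y : ℕ → Ω → Vec n) (k : ℕ) :
    obsSigma (fun k ω => φ (Y k ω)) k = obsSigma Y k := by
  simp only [obsSigma, comap_comp_diffeo hφ hφ']

theorem stateSigma_comp_diffeo {Ω : Type*} [MeasurableSpace Ω] (hφ : ContDiff ℝ 2 φ)
    (hφ' : ContDiff ℝ 2 φ.symm) (X : ℝ → Ω → Vec n) (r : ℝ) :
    stateSigma (fun s ω => φ (X s ω)) r = stateSigma X r := by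
  simp only [stateSigma, comap_comp_diffeo hφ hφ']

theorem history_comp_diffeo {Ω : Type*} [MeasurableSpace Ω] {q : ℕ} {θ : Vec q ≃ Vec q}
    (hφ : ContDiff ℝ 2 φ) (hφ' : ContDiff ℝ 2 φ.symm) (hθ : ContDiff ℝ 2 θ)
    (hθ' : ContDiff ℝ 2 θ.symm) (t : ℕ → ℝ) (X : ℝ → Ω → Vec n) (Y : ℕ → Ω → Vec q) (r : ℝ) :
    history t (fun s ω => φ (X s ω)) (fun k ω => θ (Y k ω)) r = history t X Y r := by
  simp only [history, stateSigma_comp_diffeo hφ hφ', comap_comp_diffeo hθ hθ']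

/-- The inverse exponential at `φ m` of `φ x` is `Dφ(m)(x - m)`, linear in `x`, so first and second
moments transform exactly. Gaussianity serves only to make them finite. -/
theorem IsNormal.isCenteredAt_flatConn (hφ : ContDiff ℝ 2 φ) (hφ' : ContDiff ℝ 2 φ.symm)
    {ν : Measure (Vec n)} {m : Vec n} {C : Mat n n} (h : IsNormal ν m C) :
    IsCenteredAt (flatConn φ) (ν.map φ) (φ m) (jac φ m * C * (jac φ m)ᵀ) := by
  have hG := h.1
  have hemb := measurableEmbedding_of_contDiff hφ hφ'
  have hL2 : ∀ k, MemLp (fun x : Vec n => x k) 2 ν := fun k =>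
    (IsGaussian.memLp_id ν 2 (by simp)).continuousLinearMap_comp
      (ContinuousLinearMap.proj (R := ℝ) k)
  have hL2' : ∀ k, MemLp (fun x : Vec n => x k - m k) 2 ν := fun k =>
    (hL2 k).sub (memLp_const _)
  have hI : ∀ k, Integrable (fun x : Vec n => x k - m k) ν := fun k =>
    (hL2' k).integrable (by norm_num)
  have hI0 : ∀ k, ∫ x : Vec n, (x k - m k) ∂ν = 0 := fun k => by
    rw [integral_sub ((hL2 k).integrable (by norm_num)) (integrable_const _), h.2.1 k]
    simp
  have hI2 : ∀ k l, Integrable (fun x : Vec n => (x k - m k) * (x l - m l)) ν := fun k l =>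
    (hL2' k).integrable_mul (hL2' l)
  have hl : ∀ x i, fderiv ℝ φ m (φ.symm (φ x) - m) i = ∑ k, jac φ m i k * (x k - m k) :=
    fun x i => by
      rw [φ.symm_apply_apply, ← jac_mulVec]
      rfl
  refine ⟨fun s => fderiv ℝ φ m (φ.symm s - m), ?_, ?_, fun i => ?_, fun i j => ?_⟩
  · exact ((fderiv ℝ φ m).continuous.comp (hφ'.continuous.sub continuous_const)).measurable
  · refine .of_forall fun s => (isExp_flatConn hφ hφ' _ _ _).2 ?_
    rw [fderiv_symm_fderiv hφ hφ', φ.symm_apply_apply, add_sub_cancel, φ.apply_symm_apply]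
  · rw [hemb.integrable_map_iff, hemb.integral_map]
    simp only [Function.comp_def, hl]
    refine ⟨integrable_finsetSum _ fun k _ => (hI k).const_mul _, ?_⟩
    rw [integral_finsetSum _ fun k _ => (hI k).const_mul _]
    simp only [integral_const_mul, hI0, mul_zero, Finset.sum_const_zero]
  · rw [hemb.integrable_map_iff, hemb.integral_map]
    have hprod : ∀ x : Vec n, (∑ k, jac φ m i k * (x k - m k)) * (∑ l, jac φ m j l * (x l - m l))
        = ∑ k, ∑ l, (jac φ m i k * jac φ m j l) * ((x k - m k) * (x l - m l)) := fun x => by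
      rw [Finset.sum_mul_sum]
      exact Finset.sum_congr rfl fun k _ => Finset.sum_congr rfl fun l _ => by ring
    simp only [Function.comp_def, hl, hprod]
    have hkl : ∀ k l, Integrable (fun x : Vec n =>
        (jac φ m i k * jac φ m j l) * ((x k - m k) * (x l - m l))) ν := fun k l =>
      (hI2 k l).const_mul _
    refine ⟨integrable_finsetSum _ fun k _ => integrable_finsetSum _ fun l _ => hkl k l, ?_⟩
    rw [integral_finsetSum _ fun k _ => integrable_finsetSum _ fun l _ => hkl k l]
    simp only [integral_finsetSum _ fun l _ => hkl _ l, integral_const_mul, h.2.2,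
      Matrix.mul_apply, Matrix.transpose_apply, Finset.sum_mul]
    rw [Finset.sum_comm]
    exact Finset.sum_congr rfl fun k _ => Finset.sum_congr rfl fun l _ => by ring

/-- Itô's formula at the level of generators: the second-order chain rule for `f ∘ φ` yields the
conjugated diffusion variance and the extra drift. -/
theorem generator_map {q : ℕ} (S : Model n q) (θ : Vec q ≃ Vec q) (hφ : ContDiff ℝ 2 φ)
    {f : Vec n → ℝ} (hf : ContDiff ℝ 2 f) (x : Vec n) :
    generator (S.map φ θ).b (S.map φ θ).σ f (φ x) = generator S.b S.σ (f ∘ φ) x := by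
  have h1 : fderiv ℝ (f ∘ φ) x = (fderiv ℝ f (φ x)).comp (fderiv ℝ φ x) :=
    fderiv_comp x (hf.differentiable (by norm_num) _) (hφ.differentiable (by norm_num) _)
  have h2 : contract (hess (f ∘ φ) x) (S.σ x * (S.σ x)ᵀ)
      = contract (hess f (φ x)) (jac φ x * (S.σ x * (S.σ x)ᵀ) * (jac φ x)ᵀ)
        + fderiv ℝ f (φ x) (contract (hess φ x) (S.σ x * (S.σ x)ᵀ)) := by
    have h3 := contract_conj (fderiv ℝ (fderiv ℝ f) (φ x)) (jac φ x) (S.σ x * (S.σ x)ᵀ)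
    simp only [jac_mulVec] at h3
    have h4 : contract (hess f (φ x)) (jac φ x * (S.σ x * (S.σ x)ᵀ) * (jac φ x)ᵀ)
      = contract (fun u v => fderiv ℝ (fderiv ℝ f) (φ x) (fderiv ℝ φ x u) (fderiv ℝ φ x v))
        (S.σ x * (S.σ x)ᵀ) := h3.symm
    rw [h4, ← contract_clm, ← contract_add]
    exact contract_congr (fun u v => hess_comp hf hφ x u v) _
  simp only [generator, h1, h2, Model.map, φ.symm_apply_apply, Model.α, Matrix.transpose_mul,
    map_add, map_smul, jac_mulVec, ContinuousLinearMap.comp_apply, smul_eq_mul, Matrix.mul_assoc]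
  ring

variable {Ω : Type*} [MeasurableSpace Ω] {P : Measure Ω} {q : ℕ} {θ : Vec q ≃ Vec q}

/-- The test function `f ∘ φ` is again `C²` with compact support, and its generator has the same
bounds on the same events. -/
theorem IsDiffusion.map {t : ℕ → ℝ} {X : ℝ → Ω → Vec n} {Y : ℕ → Ω → Vec q}
    {S : ℕ → Ω → Model n q} (hφ : ContDiff ℝ 2 φ) (hφ' : ContDiff ℝ 2 φ.symm)
    (hθ : ContDiff ℝ 2 θ) (hθ' : ContDiff ℝ 2 θ.symm)
    (h : IsDiffusion P t X Y (fun k ω => (S k ω).b) fun k ω => (S k ω).σ) :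
    IsDiffusion P t (fun r ω => φ (X r ω)) (fun k ω => θ (Y k ω))
      (fun k ω => ((S k ω).map φ θ).b) fun k ω => ((S k ω).map φ θ).σ := by
  intro k f hf hfc s r hs hsr hr D hD hbd
  rw [history_comp_diffeo hφ hφ' hθ hθ'] at hD
  simp only [generator_map _ θ hφ hf]
  have hfc' : HasCompactSupport (f ∘ φ) :=
    hfc.comp_homeomorph (Homeomorph.mk φ hφ.continuous hφ'.continuous)
  refine h k (f ∘ φ) (hf.comp hφ) hfc' s r hs hsr hr D hD ?_
  obtain ⟨c, hc⟩ := hbd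
  exact ⟨c, fun ω hω x => by rw [← generator_map _ θ hφ hf]; exact hc ω hω (φ x)⟩

theorem HasObsLaw.map {t : ℕ → ℝ} {X : ℝ → Ω → Vec n} {Y : ℕ → Ω → Vec q}
    {K : ℕ → Ω → Vec n → Measure (Vec q)} (hφ : ContDiff ℝ 2 φ) (hφ' : ContDiff ℝ 2 φ.symm)
    (hθ : ContDiff ℝ 2 θ) (hθ' : ContDiff ℝ 2 θ.symm) (h : HasObsLaw P t X Y K) :
    HasObsLaw P t (fun r ω => φ (X r ω)) (fun k ω => θ (Y k ω))
      fun k ω y => (K k ω (φ.symm y)).map θ := by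
  have hm := hθ.continuous.measurable
  refine ⟨fun k ω x => ?_, fun k s hs => ?_, fun k s hs => ?_⟩
  · have := h.1 k ω (φ.symm x)
    exact Measure.isProbabilityMeasure_map hm.aemeasurable
  · simp only [Measure.map_apply hm hs]
    rw [obsSigma_comp_diffeo hθ hθ']
    have h1 := h.2.1 k _ (hm hs)
    exact measurable_comp_snd h1 hφ'.continuous
  · rw [stateSigma_comp_diffeo hφ hφ', obsSigma_comp_diffeo hθ hθ']
    have h1 := h.2.2 k _ (hm hs)
    simp only [φ.symm_apply_apply, measureReal_def, Measure.map_apply hm hs]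
    exact h1

end Probability

end GIF

end

/-! ### The transformed filtering system and the filter recursion -/

theorem proposition6p2 {Ω : Type*} [MeasurableSpace Ω] (P : MeasureTheory.Measure Ω)
    [MeasureTheory.IsProbabilityMeasure P] {p q : ℕ}
    (t : ℕ → ℝ) (ht0 : t 0 = 0) (ht : StrictMono t)
    (X : ℝ → Ω → GIF.Vec p) (Y : ℕ → Ω → GIF.Vec q)
    (A σ g : ℕ → Ω → GIF.Mat p p) (J : ℕ → Ω → GIF.Mat q p) (B : ℕ → Ω → GIF.Mat q q)
    (m₀ : GIF.Vec p) (C₀ : GIF.Mat p p)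
    (hXY : GIF.IsLinearGaussianSystem P t X Y A σ J B m₀ C₀)
    (hB : ∀ n ω, (B n ω).PosDef)
    (hg : ∀ n ω, (g n ω).PosDef)
    (hgσ : ∀ n ω, σ n ω * (σ n ω)ᵀ * g n ω * (σ n ω * (σ n ω)ᵀ) = σ n ω * (σ n ω)ᵀ)
    (φ : GIF.Vec p ≃ GIF.Vec p) (hφ : ContDiff ℝ 2 φ) (hφ' : ContDiff ℝ 2 φ.symm)
    (θ : GIF.Vec q ≃ GIF.Vec q) (hθ : ContDiff ℝ 2 θ) (hθ' : ContDiff ℝ 2 θ.symm) :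
    -- the transformed system follows the transformed filtering model
    GIF.IsFilteringSystem P t (fun r ω => φ (X r ω)) (fun n ω => θ (Y n ω))
      (fun n ω => (GIF.linearModel (A n ω) (σ n ω) (g n ω) (J n ω) (B n ω)).map φ θ)
      (φ m₀) (GIF.jac φ m₀ * C₀ * (GIF.jac φ m₀)ᵀ) ∧
    -- the GI filter for it produces exactly the transforms of the Kalman filter estimates
    ∀ ω, ∀ (m : ℕ → GIF.Vec p) (C : ℕ → GIF.Mat p p),
      GIF.IsGIFilter t
          (fun n => (GIF.linearModel (A n ω) (σ n ω) (g n ω) (J n ω) (B n ω)).map φ θ)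
          (fun n => θ (Y n ω)) (φ m₀) (GIF.jac φ m₀ * C₀ * (GIF.jac φ m₀)ᵀ) m C ↔
        ∀ n,
          let k := GIF.kalman t (fun n => A n ω) (fun n => σ n ω) (fun n => J n ω)
            (fun n => B n ω) (fun n => Y n ω) m₀ C₀ n
          m n = φ k.1 ∧ C n = GIF.jac φ k.1 * k.2 * (GIF.jac φ k.1)ᵀ := by
  refine ⟨?_, fun ω m C => ?_⟩
  · obtain ⟨K, hK, hKn⟩ := hXY.obs
    exact
    { X_meas := fun r hr => hφ.continuous.measurable.comp (hXY.X_meas r hr)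
      X_cont := fun ω => hφ.continuous.comp_continuousOn (hXY.X_cont ω)
      Y_meas := fun n => hθ.continuous.measurable.comp (hXY.Y_meas n)
      admissible := fun n ω => GIF.isAdmissible_map_linearModel _ _ hφ hφ' hθ hθ' (hg n ω)
        (hB n ω) (hgσ n ω)
      b_adapted := fun n x => by
        rw [GIF.obsSigma_comp_diffeo hθ hθ']
        exact GIF.measurable_linearMap_add _ _ (GIF.measurable_mulVec (hXY.A_adapted n) _)
          (GIF.measurable_contract (GIF.measurable_mul_apply (hXY.σ_adapted n)
            fun i j => hXY.σ_adapted n j i) _)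
      σ_adapted := fun n x i j => by
        rw [GIF.obsSigma_comp_diffeo hθ hθ']
        exact GIF.measurable_mul_apply (M := fun _ => GIF.jac φ (φ.symm x))
          (fun _ _ => measurable_const) (hXY.σ_adapted n) i j
      ψ_adapted := fun n x => by
        rw [GIF.obsSigma_comp_diffeo hθ hθ']
        exact hθ.continuous.measurable.comp (GIF.measurable_mulVec (hXY.J_adapted n) _)
      β_adapted := fun n y i j => by
        rw [GIF.obsSigma_comp_diffeo hθ hθ']
        exact GIF.measurable_mul_apply (N := fun _ => (GIF.jac θ (θ.symm y))ᵀ)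
          (GIF.measurable_mul_apply (M := fun _ => GIF.jac θ (θ.symm y))
            (fun _ _ => measurable_const) (hXY.B_adapted n)) (fun _ _ => measurable_const) i j
      initial := fun ω => by
        rw [GIF.stateConn_map_linearModel _ _ _ hφ hφ' (hg 0 ω)]
        have h1 : P.map (fun ω => φ (X 0 ω)) = (P.map (X 0)).map φ :=
          (MeasureTheory.Measure.map_map hφ.continuous.measurable (hXY.X_meas 0 le_rfl)).symm
        rw [h1]
        exact hXY.initial.isCenteredAt_flatConn hφ hφ'
      state := GIF.IsDiffusion.map (S := fun n ω =>
        GIF.linearModel (A n ω) (σ n ω) (g n ω) (J n ω) (B n ω)) hφ hφ' hθ hθ' hXY.state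
      obs := ⟨_, hK.map hφ hφ' hθ hθ', fun n ω x => by
        rw [GIF.obsConn_map_linearModel _ _ _ hθ hθ' (hB n ω)]
        have h1 := (hKn n ω (φ.symm x)).isCenteredAt_flatConn hθ hθ'
        have h2 : ((GIF.linearModel (A n ω) (σ n ω) (g n ω) (J n ω) (B n ω)).map φ θ).β
            (((GIF.linearModel (A n ω) (σ n ω) (g n ω) (J n ω) (B n ω)).map φ θ).ψ x)
            = GIF.jac θ (J n ω *ᵥ φ.symm x) * B n ω * (GIF.jac θ (J n ω *ᵥ φ.symm x))ᵀ := by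
          simp only [GIF.Model.map, GIF.linearModel, Equiv.symm_apply_apply]
        rw [h2]
        exact h1⟩ }
  · constructor
    · rintro ⟨h0, h0', hstep⟩ n
      induction n with
      -- The one-step equivalence applies only to an estimate already known to be the transform of a
      -- Kalman estimate, hence the induction; in the converse direction this is given for all `n`
      -- at once.
      | zero => exact ⟨h0, h0'⟩
      | succ n ih =>
        have h := hstep n
        rw [ih.1, ih.2, GIF.giStep_map_linearModel_iff _ _ _ _ _ hφ hφ' hθ hθ' (hg n ω)
          (hB n ω)] at h
        exact h
    · intro h
      refine ⟨(h 0).1, (h 0).2, fun n => ?_⟩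
      rw [(h n).1, (h n).2, GIF.giStep_map_linearModel_iff _ _ _ _ _ hφ hφ' hθ hθ' (hg n ω)
        (hB n ω)]
      exact h (n + 1)
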